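/- **Sorting a single set under uncertainty with predictions.** An instance consists of $n\ge 0$ uncertainty intervals $I_1,\dots,I_n$, each either open, $I_i=(L_i,U_i)$ with real $L_i<U_i$, or trivial, $I_i=\{w_i\}$; predicted values $\overline{w}_i\in I_i$; and true values $w_i\in I_i$. An algorithm is given the intervals and the predictions; the value $w_i$ of a non-trivial interval is revealed only by querying $I_i$. The algorithm may choose its queries adaptively, never queries a trivial or an already queried interval, and must output an ordering of all $n$ intervals in non-decreasing order of true value. A set $Q$ of intervals is a *feasible query set* for a value vector $w$ if there is one ordering of the $n$ intervals that is non-decreasing for every vector $v$ with $v_i\in I_i$ for all $i$ and $v_i=w_i$ for all $I_i\in Q$. Let $\mathrm{opt}$ be the minimum size of a feasible query set for the true values $w$. Let $\mathcal I_R$ (resp. $\mathcal I_P$) be the set of intervals that lie in every feasible query set for $w$ (resp. for $\overline w$). The error measures are: * $k_\#=|\{i: w_i\ne\overline w_i\}|$; * $k_M=|\mathcal I_P\,\triangle\,\mathcal I_R|$; * $k_h=\sum_{i=1}^n h_i$, where $h_i$ is the number of non-trivial $I_j$ such that one of $w_i,\overline w_i$ is $\le L_j$ and the other is $>L_j$,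 plus the number of non-trivial $I_j$ such that one of $w_i,\overline w_i$ is $<U_j$ and the other is $\ge U_j$, plus the number of trivial $I_j=\{w_j\}$ such that one of $w_i,\overline w_i$ is $<w_j$ and the other is $>w_j$. **Theorem.** There is a single deterministic polynomial-time algorithm which solves every instance and which, for each $k\in\{k_\#,k_M,k_h\}$, makes at most $$\min\Big\{1+\frac{k}{\mathrm{opt}},\,2\Big\}\cdot\mathrm{opt}$$ queries (in particular none if $\mathrm{opt}=0$). Here polynomial time means: the algorithm is one program (the same for all $n$) for a random access machine whose memory consists of finitely many arrays of natural numbers, with addition and truncated subtraction of natural numbers, which accesses interval endpoints, predictions and revealed values only by comparing two of them, and which halts within $p(n)$ steps for a fixed polynomial $p$. -/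

import Mathlib

namespace UncertainSorting

/-! ### Uncertainty intervals, query sets and prediction errors -/

/-- `n` uncertainty intervals. The `i`-th one is the open interval `(lower i, upper i)` if
`lower i < upper i`, and the one-point set `{lower i}` if `lower i = upper i` (see `ivl`). -/
structure Intervals (n : ℕ) where
  lower : Fin n → ℝ
  upper : Fin n → ℝ
  lower_le_upper : ∀ i, lower i ≤ upper i

namespace Intervals

variable {n : ℕ} (I : Intervals n)

/-- The `i`-th interval is trivial, i.e. a single point. -/
def Trivial (i : Fin n) : Prop := I.lower i = I.upper i

/-- The `i`-th uncertainty interval as a set of reals. -/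
noncomputable def ivl (i : Fin n) : Set ℝ :=
  if I.lower i = I.upper i then {I.lower i} else Set.Ioo (I.lower i) (I.upper i)

/-- `w` is a possible vector of values: every value lies in its interval. -/
def IsRealization (w : Fin n → ℝ) : Prop := ∀ i, w i ∈ I.ivl i

/-- `Q` is a feasible query set for sorting all `n` elements when the true values are `w`: once
the values in `Q` are revealed, some fixed order is certain to be non-decreasing, that is, it is
non-decreasing for every realization that agrees with `w` on `Q`.
(`σ j` is the element at position `j` of the order.) -/
def Feasible (w : Fin n → ℝ) (Q : Finset (Fin n)) : Prop :=
  ∃ σ : Equiv.Perm (Fin n), ∀ v : Fin n → ℝ,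
    I.IsRealization v → (∀ i ∈ Q, v i = w i) → Monotone (v ∘ σ)

/-- Querying everything is feasible, so the minimum in `opt` is over a non-empty set. -/
theorem feasible_univ (w : Fin n → ℝ) : I.Feasible w Finset.univ :=
  ⟨Tuple.sort w, fun v _ hv => by
    have h : v = w := funext fun i => hv i (Finset.mem_univ i)
    rw [h]
    exact Tuple.monotone_sort w⟩

/-- The minimum cardinality of a feasible query set for the values `w`. -/
noncomputable def opt (w : Fin n → ℝ) : ℕ :=
  sInf {c : ℕ | ∃ Q : Finset (Fin n), I.Feasible w Q ∧ Q.card = c}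

/-- The elements that belong to every feasible query set for the values `w`. -/
def mandatory (w : Fin n → ℝ) : Set (Fin n) :=
  {i | ∀ Q : Finset (Fin n), I.Feasible w Q → i ∈ Q}

end Intervals

/-- What the algorithm is given: uncertainty intervals and a predicted value in each of them. -/
structure Input (n : ℕ) extends Intervals n where
  pred : Fin n → ℝ
  pred_mem : toIntervals.IsRealization pred

namespace Input

variable {n : ℕ} (I : Input n)

/-- `k_#`: the number of wrong predictions. -/
noncomputable def numErrors (w : Fin n → ℝ) : ℕ := {i | w i ≠ I.pred i}.ncard

/-- `k_M`: the mandatory query distance, the size of the symmetric difference of the set of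
prediction mandatory elements and the set of mandatory elements. -/
noncomputable def mandatoryDist (w : Fin n → ℝ) : ℕ :=
  (symmDiff (I.mandatory I.pred) (I.mandatory w)).ncard

/-- One of `x`, `y` is `≤ l` and the other one is `> l`. -/
def PassesLower (x y l : ℝ) : Prop := (x ≤ l ∧ l < y) ∨ (y ≤ l ∧ l < x)

/-- One of `x`, `y` is `< u` and the other one is `≥ u`. -/
def PassesUpper (x y u : ℝ) : Prop := (x < u ∧ u ≤ y) ∨ (y < u ∧ u ≤ x)

/-- One of `x`, `y` is `< z` and the other one is `> z`. -/
def JumpsOver (x y z : ℝ) : Prop := (x < z ∧ z < y) ∨ (y < z ∧ z < x)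

/-- `h_i`: the number of non-trivial intervals whose left endpoint the value of `i` passes over,
plus the number of those whose right endpoint it passes over, plus the number of trivial
intervals that it jumps over. -/
noncomputable def hops (w : Fin n → ℝ) (i : Fin n) : ℕ :=
  {j | ¬ I.Trivial j ∧ PassesLower (w i) (I.pred i) (I.lower j)}.ncard
    + {j | ¬ I.Trivial j ∧ PassesUpper (w i) (I.pred i) (I.upper j)}.ncard
    + {j | I.Trivial j ∧ JumpsOver (w i) (I.pred i) (I.lower j)}.ncard

/-- `k_h`: the hop distance. -/
noncomputable def hopDist (w : Fin n → ℝ) : ℕ := ∑ i, I.hops w i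

end Input

/-! ### Machine model

Deterministic programs on a random access machine. Its memory consists of arrays of natural
numbers (a program mentions only finitely many of them), initially zero. Real numbers can only be
compared: the endpoints and the predicted values, and the values revealed by queries. A program is
a fixed finite text that does not depend on the input. -/

/-- Index expressions. -/
inductive Expr where
  | const (c : ℕ)
  /-- the number `n` of intervals -/
  | size
  /-- the entry of array `arr` at the index given by an expression -/
  | load (arr : ℕ) (idx : Expr)
  | add (a b : Expr)
  /-- truncated subtraction -/
  | sub (a b : Expr)

/-- References to real numbers; the index of the interval is given by an expression. -/
inductive RealRef where
  | lower (i : Expr)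
  | upper (i : Expr)
  | pred (i : Expr)
  | value (i : Expr)

/-- Tests. -/
inductive Test where
  | natLt (a b : Expr)
  | realLt (x y : RealRef)
  | neg (c : Test)
  | conj (c d : Test)

/-- Programs. -/
inductive Prog where
  | skip
  /-- write the value of `val` into array `arr` at index `idx` -/
  | store (arr : ℕ) (idx val : Expr)
  /-- query the interval with index `i` -/
  | query (i : Expr)
  | seq (P Q : Prog)
  | ite (c : Test) (P Q : Prog)
  | while (c : Test) (P : Prog)

/-- A state: the memory (array, index, content) and the list of all queries made so far, the most
recent one first. -/
structure State (n : ℕ) where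
  mem : ℕ → ℕ → ℕ
  log : List (Fin n)

/-- The initial state: zero memory, no queries. -/
def State.init (n : ℕ) : State n := ⟨fun _ _ => 0, []⟩

variable {n : ℕ}

def Expr.eval (s : State n) : Expr → ℕ
  | const c => c
  | size => n
  | load arr idx => s.mem arr (idx.eval s)
  | add a b => a.eval s + b.eval s
  | sub a b => a.eval s - b.eval s

/-- `r.Denotes I w s x`: in state `s` the reference `r` gives access to the real number `x`.
The true values `w` are accessible only at elements that have been queried. -/
def RealRef.Denotes (I : Input n) (w : Fin n → ℝ) (s : State n) : RealRef → ℝ → Prop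
  | lower e, x => ∃ i : Fin n, e.eval s = i ∧ x = I.lower i
  | upper e, x => ∃ i : Fin n, e.eval s = i ∧ x = I.upper i
  | pred e, x => ∃ i : Fin n, e.eval s = i ∧ x = I.pred i
  | value e, x => ∃ i : Fin n, e.eval s = i ∧ i ∈ s.log ∧ x = w i

/-- A comparison of reals fails if one of the two references is not accessible. -/
def Test.Holds (I : Input n) (w : Fin n → ℝ) (s : State n) : Test → Prop
  | natLt a b => a.eval s < b.eval s
  | realLt r r' => ∃ x y, r.Denotes I w s x ∧ r'.Denotes I w s y ∧ x < y
  | neg c => ¬ c.Holds I w s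
  | conj c d => c.Holds I w s ∧ d.Holds I w s

/-- `Exec I w P s s' t`: on input `I`, with true values `w`, the program `P` started in state `s`
halts in state `s'` after `t` steps. Each executed assignment, query, `skip` and evaluation of a
test is one step. -/
inductive Exec (I : Input n) (w : Fin n → ℝ) : Prog → State n → State n → ℕ → Prop
  | skip (s : State n) : Exec I w .skip s s 1
  | store (arr : ℕ) (idx val : Expr) (s : State n) :
      Exec I w (.store arr idx val) s
        ⟨Function.update s.mem arr
          (Function.update (s.mem arr) (idx.eval s) (val.eval s)), s.log⟩ 1
  | query (e : Expr) (s : State n) (i : Fin n) (h : e.eval s = i) :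
      Exec I w (.query e) s ⟨s.mem, i :: s.log⟩ 1
  | seq {P Q : Prog} {s s' s'' : State n} {t t' : ℕ} (hP : Exec I w P s s' t)
      (hQ : Exec I w Q s' s'' t') : Exec I w (.seq P Q) s s'' (t + t')
  | ite_true {c : Test} {P Q : Prog} {s s' : State n} {t : ℕ} (hc : c.Holds I w s)
      (hP : Exec I w P s s' t) : Exec I w (.ite c P Q) s s' (t + 1)
  | ite_false {c : Test} {P Q : Prog} {s s' : State n} {t : ℕ} (hc : ¬ c.Holds I w s)
      (hQ : Exec I w Q s s' t) : Exec I w (.ite c P Q) s s' (t + 1)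
  | while_true {c : Test} {P : Prog} {s s' s'' : State n} {t t' : ℕ} (hc : c.Holds I w s)
      (hP : Exec I w P s s' t) (hW : Exec I w (.while c P) s' s'' t') :
      Exec I w (.while c P) s s'' (t + t' + 1)
  | while_false {c : Test} {P : Prog} {s : State n} (hc : ¬ c.Holds I w s) :
      Exec I w (.while c P) s s 1

/-- Execution is deterministic, so a program has at most one run on each instance. -/
theorem Exec.unique {I : Input n} {w : Fin n → ℝ} {P : Prog} {s s₁ s₂ : State n} {t₁ t₂ : ℕ}
    (h₁ : Exec I w P s s₁ t₁) (h₂ : Exec I w P s s₂ t₂) : s₁ = s₂ ∧ t₁ = t₂ := by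
  induction h₁ generalizing s₂ t₂ with
  | skip s => cases h₂; exact ⟨rfl, rfl⟩
  | store arr idx val s => cases h₂; exact ⟨rfl, rfl⟩
  | query e s i h =>
    cases h₂ with
    | query _ _ j h' =>
      have hij : i = j := Fin.ext (h.symm.trans h')
      subst hij
      exact ⟨rfl, rfl⟩
  | seq _ _ ihP ihQ =>
    cases h₂ with
    | seq hP hQ =>
      obtain ⟨rfl, rfl⟩ := ihP hP
      obtain ⟨rfl, rfl⟩ := ihQ hQ
      exact ⟨rfl, rfl⟩
  | ite_true hc _ ih =>
    cases h₂ with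
    | ite_true _ h => obtain ⟨rfl, rfl⟩ := ih h; exact ⟨rfl, rfl⟩
    | ite_false hc' _ => exact absurd hc hc'
  | ite_false hc _ ih =>
    cases h₂ with
    | ite_true hc' _ => exact absurd hc' hc
    | ite_false _ h => obtain ⟨rfl, rfl⟩ := ih h; exact ⟨rfl, rfl⟩
  | while_true hc _ _ ihP ihW =>
    cases h₂ with
    | while_true _ hP hW =>
      obtain ⟨rfl, rfl⟩ := ihP hP
      obtain ⟨rfl, rfl⟩ := ihW hW
      exact ⟨rfl, rfl⟩
    | while_false hc' => exact absurd hc hc'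
  | while_false hc =>
    cases h₂ with
    | while_true hc' _ _ => exact absurd hc' hc
    | while_false _ => exact ⟨rfl, rfl⟩

/-- The first `n` entries of array `0` list the elements in non-decreasing order of their
true values. -/
def State.OutputsSorted (s : State n) (w : Fin n → ℝ) : Prop :=
  ∃ σ : Equiv.Perm (Fin n), (∀ j : Fin n, s.mem 0 j = σ j) ∧ Monotone (w ∘ σ)

end UncertainSorting

namespace UncertainSorting

variable {n : ℕ}

/-! ### Formulas over the input and the revealed values -/

/-! Join two distinct non-trivial intervals when they meet. A feasible set contains every interval
into which the value of another element falls (`Feasible.mem_of_inside`), and it is a vertex cover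
(`Feasible.mem_or_mem`). Conversely, once the remaining intervals neither overlap nor contain known
values, the order is fixed (`Determined.feasible`). Every bound is proved against an arbitrary
feasible `Q`.

The algorithm prefers urgent intervals: those containing another non-trivial interval, another
prediction, or a revealed value. When none is urgent, no three unqueried intervals meet pairwise
(`no_triangle`), so any remaining edges yield a leaf `y`. Its only unqueried neighbour `x` is
queried.

Error bounds: if `x` is queried outside `Q` with a leaf `y` that is never queried, then `y` lies in
`Q` and pays. Every other query outside `Q` is charged injectively to an error
(`length_le_card_add_of_charge`): either a prediction fell into `x` and no value did, or the value
of `x` fell into `y` and no prediction did. The hop distance dominates the mandatory distance.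

Factor two: an interval containing another one is in every feasible set, so its budget of two leaves
one spare unit. The proper intervals are swept from left to right (`count_le`). Since `Q` covers all
edges, a component can exceed its budget only if all of it is queried, `Q` takes exactly its even
positions, and its last position is odd. A spare unit pays if the prediction of an interval
containing another falls into an odd position; otherwise `Tight.not_oddPos` excludes the case. That
lemma is what the priority of leaves in odd position is for.

Running time: the query rule is a fixed formula with a parity quantifier, which expresses odd
positions. Formulas compile to nested loops of polynomial length (`Formula.decides_compile`). -/

/-- A real number belonging to the element that a variable stands for. -/
inductive Ref where
  | lower (k : ℕ)
  | upper (k : ℕ)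
  | pred (k : ℕ)
  | value (k : ℕ)

namespace Ref

/-- The variable of a reference. -/
def idx : Ref → ℕ
  | lower k => k
  | upper k => k
  | pred k => k
  | value k => k

/-- The real number that a reference denotes. -/
def real (I : Input n) (w : Fin n → ℝ) (e : ℕ → Fin n) : Ref → ℝ
  | lower k => I.lower (e k)
  | upper k => I.upper (e k)
  | pred k => I.pred (e k)
  | value k => w (e k)

/-- A reference to a true value is known if the element has been queried. -/
def Known (l : List (Fin n)) (e : ℕ → Fin n) : Ref → Prop
  | value k => e k ∈ l
  | _ => True

end Ref

/-- First-order formulas with a parity quantifier. Variables are numbered by levels: a quantifier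
below `d` others binds the variable `d`. -/
inductive Formula where
  | lt (a b : Ref)
  | idxLt (k m : ℕ)
  | not (φ : Formula)
  | and (φ ψ : Formula)
  | ex (φ : Formula)
  /-- an odd number of elements satisfy `φ` -/
  | odd (φ : Formula)

namespace Formula

/-- All variables in scope `d` are bound. -/
def closed : Formula → ℕ → Bool
  | lt a b, d => decide (a.idx < d) && decide (b.idx < d)
  | idxLt k m, d => decide (k < d) && decide (m < d)
  | not φ, d => φ.closed d
  | and φ ψ, d => φ.closed d && ψ.closed d
  | ex φ, d => φ.closed (d + 1)
  | odd φ, d => φ.closed (d + 1)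

open Classical in
/-- Satisfaction of a formula when the elements of `l` have been queried. -/
def Sat (I : Input n) (w : Fin n → ℝ) (l : List (Fin n)) : Formula → ℕ → (ℕ → Fin n) → Prop
  | lt a b, _, e => a.Known l e ∧ b.Known l e ∧ a.real I w e < b.real I w e
  | idxLt k m, _, e => e k < e m
  | not φ, d, e => ¬ φ.Sat I w l d e
  | and φ ψ, d, e => φ.Sat I w l d e ∧ ψ.Sat I w l d e
  | ex φ, d, e => ∃ i, φ.Sat I w l (d + 1) (Function.update e d i)
  | odd φ, d, e =>
    Odd (Finset.univ.filter fun i => φ.Sat I w l (d + 1) (Function.update e d i)).card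

end Formula

/-! ### Compiling formulas to programs -/

/-- Write `v` into array `a` at index `i`. -/
def State.set (s : State n) (a i v : ℕ) : State n :=
  ⟨Function.update s.mem a (Function.update (s.mem a) i v), s.log⟩

@[simp] theorem State.set_log (s : State n) (a i v : ℕ) : (s.set a i v).log = s.log := rfl

theorem State.set_mem (s : State n) (a i v b j : ℕ) :
    (s.set a i v).mem b j = if b = a ∧ j = i then v else s.mem b j := by
  unfold State.set
  by_cases hb : b = a
  · subst hb
    by_cases hj : j = i
    · subst hj; simp
    · simp [hj]
  · simp [hb]

theorem Exec.store_set {I : Input n} {w : Fin n → ℝ} (a : ℕ) (i v : Expr) (s : State n) :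
    Exec I w (.store a i v) s (s.set a (i.eval s) (v.eval s)) 1 :=
  Exec.store a i v s

/-- The loop `for (mem a k) = 0, …, n - 1 do body`. -/
def Prog.forAll (a k : ℕ) (body : Prog) : Prog :=
  .seq (.store a (.const k) (.const 0))
    (.while (.natLt (.load a (.const k)) .size)
      (.seq body (.store a (.const k) (.add (.load a (.const k)) (.const 1)))))

/-- Invariant rule for the loop: the body may overwrite anything except the counter cell. Each round
adds a test and an increment to `T`; the last two steps are the initialization and the failing test.
-/
theorem Exec.forAll {I : Input n} {w : Fin n → ℝ} (a k : ℕ) (body : Prog) (s : State n) (T : ℕ)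
    (Inv : ℕ → State n → Prop) (h0 : Inv 0 (s.set a k 0))
    (hstep : ∀ i < n, ∀ s, Inv i s → s.mem a k = i →
      ∃ s' t, Exec I w body s s' t ∧ t ≤ T ∧ s'.mem a k = i ∧ Inv (i + 1) (s'.set a k (i + 1))) :
    ∃ s' t, Exec I w (.forAll a k body) s s' t ∧ t ≤ n * (T + 2) + 2 ∧ Inv n s' := by
  have main : ∀ m i (s : State n), i + m = n → Inv i s → s.mem a k = i →
      ∃ s' t, Exec I w (.while (.natLt (.load a (.const k)) .size)
        (.seq body (.store a (.const k) (.add (.load a (.const k)) (.const 1))))) s s' t ∧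
        t ≤ m * (T + 2) + 1 ∧ Inv n s' := by
    intro m
    induction m with
    | zero =>
      intro i s hi hs hm
      refine ⟨s, 1, Exec.while_false ?_, by simp, ?_⟩
      · simp [Test.Holds, Expr.eval, hm]; omega
      · have : i = n := by omega
        exact this ▸ hs
    | succ m ih =>
      intro i s hi hs hm
      obtain ⟨s₁, t₁, h₁, ht₁, hm₁, hi₁⟩ := hstep i (by omega) s hs hm
      obtain ⟨s₂, t₂, h₂, ht₂, hi₂⟩ := ih (i + 1) (s₁.set a k (i + 1)) (by omega) hi₁
        (by simp [State.set_mem])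
      have hst : Exec I w (.store a (.const k) (.add (.load a (.const k)) (.const 1))) s₁
          (s₁.set a k (i + 1)) 1 := by
        have := Exec.store_set (I := I) (w := w) a (.const k)
          (.add (.load a (.const k)) (.const 1)) s₁
        simpa [Expr.eval, hm₁] using this
      refine ⟨s₂, (t₁ + 1) + t₂ + 1, Exec.while_true ?_ (Exec.seq h₁ hst) h₂, ?_, hi₂⟩
      · simp [Test.Holds, Expr.eval, hm]; omega
      · have : (m + 1) * (T + 2) = m * (T + 2) + (T + 2) := by ring
        omega
  obtain ⟨s', t, h, ht, hi⟩ := main n 0 (s.set a k 0) (by simp) h0 (by simp [State.set_mem])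
  exact ⟨s', 1 + t, Exec.seq (Exec.store_set a (.const k) (.const 0) s) h, by omega, hi⟩

/-! ### Frame conditions and evaluation of truth values. -/

/-- The states agree except for variables from `d` on and results from `r` on. -/
def State.Agree (d r : ℕ) (s s' : State n) : Prop :=
  s'.log = s.log ∧ ∀ a i, (a = 2 → i < d) → (a = 3 → i < r) → s'.mem a i = s.mem a i

theorem State.Agree.refl (d r : ℕ) (s : State n) : s.Agree d r s := ⟨rfl, fun _ _ _ _ => rfl⟩

theorem State.Agree.trans {d r d' r' : ℕ} {s s' s'' : State n} (h : s.Agree d r s')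
    (h' : s'.Agree d' r' s'') (hd : d ≤ d') (hr : r ≤ r') : s.Agree d r s'' :=
  ⟨h'.1.trans h.1, fun a i h2 h3 =>
    (h'.2 a i (fun h => (h2 h).trans_le hd) (fun h => (h3 h).trans_le hr)).trans (h.2 a i h2 h3)⟩

theorem State.Agree.set_res {d r : ℕ} {s s' : State n} (h : s.Agree d r s') (v : ℕ) :
    s.Agree d r (s'.set 3 r v) := by
  refine ⟨h.1, fun a i h2 h3 => ?_⟩
  rw [State.set_mem, if_neg, h.2 a i h2 h3]
  rintro ⟨rfl, rfl⟩
  exact lt_irrefl _ (h3 rfl)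

theorem State.Agree.set_var {d r : ℕ} {s s' : State n} (h : s.Agree d r s') (v : ℕ) :
    s.Agree d r (s'.set 2 d v) := by
  refine ⟨h.1, fun a i h2 h3 => ?_⟩
  rw [State.set_mem, if_neg, h.2 a i h2 h3]
  rintro ⟨rfl, rfl⟩
  exact lt_irrefl _ (h2 rfl)

/-- The variable `k`. -/
def Expr.var (k : ℕ) : Expr := .load 2 (.const k)

/-- The result cell `r`. -/
def Expr.res (r : ℕ) : Expr := .load 3 (.const r)

/-- Write `v` into result cell `r`. -/
def Prog.setRes (r : ℕ) (v : Expr) : Prog := .store 3 (.const r) v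

theorem Exec.setRes {I : Input n} {w : Fin n → ℝ} (r : ℕ) (v : Expr) (s : State n) :
    Exec I w (.setRes r v) s (s.set 3 r (v.eval s)) 1 :=
  Exec.store_set 3 (.const r) v s

/-- Run `body` for all values of variable `d` and combine its results, found in cell `r + 1`, in
cell `r` by means of `upd`. -/
def Prog.accumulate (d r : ℕ) (body : Prog) (upd : Expr) : Prog :=
  .seq (.setRes r (.const 0)) (.forAll 2 d (.seq body (.setRes r upd)))

/-- The program `P` computes the truth value of `S` in cell `r`, where `S` depends on the queried
elements and the variables below `d`. -/
def Prog.Decides (I : Input n) (w : Fin n → ℝ) (P : Prog) (d r T : ℕ)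
    (S : List (Fin n) → (ℕ → Fin n) → Prop) : Prop :=
  ∀ (s : State n) (e : ℕ → Fin n), (∀ k < d, s.mem 2 k = e k) →
    ∃ s' t, Exec I w P s s' t ∧ t ≤ T ∧ s.Agree d r s' ∧
      (S s.log e → s'.mem 3 r = 1) ∧ (¬ S s.log e → s'.mem 3 r = 0)

-- After `i` rounds, cell `r` holds `g` of the number of witnesses below `i`. Varying `g` gives
-- existence, parity and counting from one loop.
open Classical in
theorem Prog.Decides.accumulate {I : Input n} {w : Fin n → ℝ} {body : Prog} {d r T : ℕ}
    {S : List (Fin n) → (ℕ → Fin n) → Prop} (hb : body.Decides I w (d + 1) (r + 1) T S)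
    (upd : Expr) (g : ℕ → ℕ)
    (h0 : g 0 = 0) (h1 : ∀ s : State n, ∀ c, s.mem 3 r = g c → s.mem 3 (r + 1) = 1 →
      upd.eval s = g (c + 1))
    (h2 : ∀ s : State n, ∀ c, s.mem 3 r = g c → s.mem 3 (r + 1) = 0 → upd.eval s = g c)
    (s : State n) (e : ℕ → Fin n) (he : ∀ k < d, s.mem 2 k = e k) :
    ∃ s' t, Exec I w (.accumulate d r body upd) s s' t ∧ t ≤ n * (T + 3) + 3 ∧ s.Agree d r s' ∧
      s'.mem 3 r = g (Finset.univ.filter fun i => S s.log (Function.update e d i)).card := by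
  obtain ⟨s', t, h, ht, hA, hr⟩ := Exec.forAll (I := I) (w := w) 2 d (.seq body (.setRes r upd))
    (s.set 3 r 0) (T + 1)
    (fun i s' => s.Agree d r s' ∧ s'.mem 3 r =
      g (Finset.univ.filter fun j : Fin n =>
        (j : ℕ) < i ∧ S s.log (Function.update e d j)).card)
    ⟨((State.Agree.refl d r s).set_res 0).set_var 0, by simp [State.set_mem, h0]⟩
    (by
      rintro i hi s₁ ⟨hA, hr⟩ hv
      obtain ⟨s₂, t₂, h, ht, hA₂, hS, hS'⟩ := hb s₁ (Function.update e d ⟨i, hi⟩) (by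
        intro k hk
        by_cases hkd : k = d
        · subst hkd; simpa using hv
        · rw [Function.update_of_ne hkd, hA.2 2 k (fun _ => by omega) (by simp), he k (by omega)])
      rw [hA.1] at hS hS'
      have hr₂ : s₂.mem 3 r = s₁.mem 3 r := hA₂.2 3 r (by simp) (by simp)
      have hA₃ : s.Agree d r s₂ := hA.trans hA₂ (by omega) (by omega)
      refine ⟨_, _, Exec.seq h (Exec.setRes r upd s₂), by omega, ?_, ?_, ?_⟩
      · rw [State.set_mem, if_neg (by simp), hA₂.2 2 d (by simp) (by simp), hv]
      · exact (hA₃.set_res _).set_var _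
      · rw [State.set_mem, if_neg (by simp), State.set_mem, if_pos ⟨rfl, rfl⟩]
        by_cases hT : S s.log (Function.update e d ⟨i, hi⟩)
        · rw [h1 s₂ _ (hr₂.trans hr) (hS hT)]
          congr 1
          rw [← Finset.card_insert_of_notMem (a := (⟨i, hi⟩ : Fin n)) (by simp)]
          congr 1
          ext j
          simp only [Finset.mem_insert, Finset.mem_filter, Finset.mem_univ, true_and]
          constructor
          · rintro (rfl | ⟨h, h'⟩)
            · exact ⟨by simp, hT⟩
            · exact ⟨by omega, h'⟩
          · rintro ⟨h, h'⟩
            rcases Nat.lt_succ_iff_lt_or_eq.1 h with h | h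
            · exact Or.inr ⟨h, h'⟩
            · exact Or.inl (Fin.ext h)
        · rw [h2 s₂ _ (hr₂.trans hr) (hS' hT)]
          congr 2
          ext j
          simp only [Finset.mem_filter, Finset.mem_univ, true_and]
          constructor
          · rintro ⟨h, h'⟩
            exact ⟨by omega, h'⟩
          · rintro ⟨h, h'⟩
            refine ⟨?_, h'⟩
            rcases Nat.lt_succ_iff_lt_or_eq.1 h with h | h
            · exact h
            · exact absurd ((Fin.ext h : j = ⟨i, hi⟩) ▸ h') hT)
  refine ⟨s', 1 + t, Exec.seq (Exec.setRes r (.const 0) s) h, ?_, hA, ?_⟩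
  · have : n * (T + 1 + 2) = n * (T + 3) := rfl
    omega
  · simpa using hr

/-- The reference in the language of the machine. -/
def Ref.compile : Ref → RealRef
  | lower k => .lower (.var k)
  | upper k => .upper (.var k)
  | pred k => .pred (.var k)
  | value k => .value (.var k)

namespace Formula

/-- A program that computes the truth value of a formula in cell `r`. -/
def compile : Formula → ℕ → ℕ → Prog
  | lt a b, _, r => .ite (.realLt a.compile b.compile) (.setRes r (.const 1)) (.setRes r (.const 0))
  | idxLt k m, _, r => .ite (.natLt (.var k) (.var m)) (.setRes r (.const 1)) (.setRes r (.const 0))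
  | not φ, d, r => .seq (φ.compile d r) (.setRes r (.sub (.const 1) (.res r)))
  -- On bits, the truncated `a + b - 1` is the conjunction.
  | and φ ψ, d, r => .seq (φ.compile d r) (.seq (ψ.compile d (r + 1))
      (.setRes r (.sub (.add (.res r) (.res (r + 1))) (.const 1))))
  -- The truncated expression `1 - (1 - (a + b))` is the minimum of `1` and `a + b`.
  | ex φ, d, r => .accumulate d r (φ.compile (d + 1) (r + 1))
      (.sub (.const 1) (.sub (.const 1) (.add (.res r) (.res (r + 1)))))
  -- The sum of both truncated differences is `|a - b|`, the exclusive or of two bits.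
  | odd φ, d, r => .accumulate d r (φ.compile (d + 1) (r + 1))
      (.add (.sub (.res r) (.res (r + 1))) (.sub (.res (r + 1)) (.res r)))

open Polynomial in
/-- A bound on the running time of `compile`. -/
noncomputable def cost : Formula → Polynomial ℕ
  | lt _ _ => 2
  | idxLt _ _ => 2
  | not φ => φ.cost + 1
  | and φ ψ => φ.cost + ψ.cost + 1
  | ex φ => X * (φ.cost + 3) + 3
  | odd φ => X * (φ.cost + 3) + 3

end Formula

theorem Ref.denotes_compile {I : Input n} {w : Fin n → ℝ} {s : State n} {e : ℕ → Fin n} (a : Ref)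
    (h : s.mem 2 a.idx = e a.idx) (x : ℝ) :
    a.compile.Denotes I w s x ↔ a.Known s.log e ∧ x = a.real I w e := by
  cases a <;> simp only [Ref.idx] at h <;>
    simp [Ref.compile, RealRef.Denotes, Expr.var, Expr.eval, Ref.Known, Ref.real, h, Fin.val_inj]

theorem Prog.decides_test {I : Input n} {w : Fin n → ℝ} {d r : ℕ} {c : Test}
    {S : List (Fin n) → (ℕ → Fin n) → Prop}
    (h : ∀ (s : State n) (e : ℕ → Fin n), (∀ k < d, s.mem 2 k = e k) →
      (c.Holds I w s ↔ S s.log e)) :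
    Prog.Decides I w (.ite c (.setRes r (.const 1)) (.setRes r (.const 0))) d r 2 S := by
  intro s e he
  by_cases hS : S s.log e
  · exact ⟨_, _, Exec.ite_true ((h s e he).2 hS) (Exec.setRes r (.const 1) s), le_rfl,
      (State.Agree.refl d r s).set_res _, fun _ => by simp [State.set_mem, Expr.eval],
      fun h => absurd hS h⟩
  · exact ⟨_, _, Exec.ite_false (fun hc => hS ((h s e he).1 hc)) (Exec.setRes r (.const 0) s),
      le_rfl, (State.Agree.refl d r s).set_res _, fun h => absurd h hS,
      fun _ => by simp [State.set_mem, Expr.eval]⟩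

-- The result cells act as a stack: a subformula evaluated into cell `r + 1` leaves cell `r` and the
-- bound variables intact, by `State.Agree`.
open Classical in
theorem Formula.decides_compile (I : Input n) (w : Fin n → ℝ) (φ : Formula) :
    ∀ d r, φ.closed d = true →
      (φ.compile d r).Decides I w d r (φ.cost.eval n) fun l e => φ.Sat I w l d e := by
  induction φ with
  | lt a b =>
    intro d r hc
    simp only [closed, Bool.and_eq_true, decide_eq_true_eq] at hc
    simp only [cost, Polynomial.eval_ofNat]
    refine Prog.decides_test fun s e he => ?_
    simp only [Test.Holds, Ref.denotes_compile a (he _ hc.1), Ref.denotes_compile b (he _ hc.2), Sat]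
    constructor
    · rintro ⟨x, y, ⟨h, rfl⟩, ⟨h', rfl⟩, hxy⟩
      exact ⟨h, h', hxy⟩
    · rintro ⟨h, h', hxy⟩
      exact ⟨_, _, ⟨h, rfl⟩, ⟨h', rfl⟩, hxy⟩
  | idxLt k m =>
    intro d r hc
    simp only [closed, Bool.and_eq_true, decide_eq_true_eq] at hc
    simp only [cost, Polynomial.eval_ofNat]
    refine Prog.decides_test fun s e he => ?_
    simp [Test.Holds, Expr.var, Expr.eval, he _ hc.1, he _ hc.2, Sat]
  | not φ ih =>
    intro d r hc s e he
    obtain ⟨s₁, t₁, h, ht, hA, h1, h0⟩ := ih d r hc s e he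
    refine ⟨_, _, Exec.seq h (Exec.setRes _ _ _), by simp [cost]; omega, hA.set_res _, ?_, ?_⟩
    · intro hS
      simp [State.set_mem, Expr.eval, Expr.res, h0 hS]
    · intro hS
      simp [State.set_mem, Expr.eval, Expr.res, h1 (not_not.1 hS)]
  | and φ ψ ihφ ihψ =>
    intro d r hc s e he
    simp only [closed, Bool.and_eq_true] at hc
    obtain ⟨s₁, t₁, h₁, ht₁, hA₁, h11, h10⟩ := ihφ d r hc.1 s e he
    obtain ⟨s₂, t₂, h₂, ht₂, hA₂, h21, h20⟩ := ihψ d (r + 1) hc.2 s₁ e fun k hk => by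
      rw [hA₁.2 2 k (fun _ => hk) (by simp), he k hk]
    rw [hA₁.1] at h21 h20
    have hr : s₂.mem 3 r = s₁.mem 3 r := hA₂.2 3 r (by simp) (by simp)
    refine ⟨_, _, Exec.seq h₁ (Exec.seq h₂ (Exec.setRes _ _ _)), by simp [cost]; omega,
      (hA₁.trans hA₂ le_rfl (by omega)).set_res _, ?_, ?_⟩
    · rintro ⟨hS, hS'⟩
      simp [State.set_mem, Expr.eval, Expr.res, hr, h11 hS, h21 hS']
    · intro hS
      by_cases hS₁ : φ.Sat I w s.log d e
      · have hS₂ : ¬ ψ.Sat I w s.log d e := fun h => hS ⟨hS₁, h⟩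
        simp [State.set_mem, Expr.eval, Expr.res, hr, h11 hS₁, h20 hS₂]
      · by_cases hS₂ : ψ.Sat I w s.log d e
        · simp [State.set_mem, Expr.eval, Expr.res, hr, h10 hS₁, h21 hS₂]
        · simp [State.set_mem, Expr.eval, Expr.res, hr, h10 hS₁, h20 hS₂]
  | ex φ ih =>
    intro d r hc s e he
    obtain ⟨s', t, h, ht, hA, hr⟩ := (ih (d + 1) (r + 1) hc).accumulate
      (.sub (.const 1) (.sub (.const 1) (.add (.res r) (.res (r + 1)))))
      (fun c => 1 - (1 - c)) rfl
      (by intro s c h h'; simp [Expr.eval, Expr.res, h, h'])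
      (by intro s c h h'; simp only [Expr.eval, Expr.res, h, h']; omega) s e he
    refine ⟨s', t, h, by simpa [cost] using ht, hA, ?_, ?_⟩
    · rintro ⟨i, hi⟩
      have : 0 < (Finset.univ.filter fun i =>
        φ.Sat I w s.log (d + 1) (Function.update e d i)).card :=
        Finset.card_pos.2 ⟨i, by simpa using hi⟩
      rw [hr]
      omega
    · intro hS
      rw [hr, Finset.filter_false_of_mem fun i _ hi => hS ⟨i, hi⟩]
      rfl
  | odd φ ih =>
    intro d r hc s e he
    obtain ⟨s', t, h, ht, hA, hr⟩ := (ih (d + 1) (r + 1) hc).accumulate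
      (.add (.sub (.res r) (.res (r + 1))) (.sub (.res (r + 1)) (.res r)))
      (fun c => c % 2) rfl
      (by intro s c h h'; simp only [Expr.eval, Expr.res, h, h']; omega)
      (by intro s c h h'; simp [Expr.eval, Expr.res, h, h']) s e he
    refine ⟨s', t, h, by simpa [cost] using ht, hA, ?_, ?_⟩
    · intro hS
      rw [hr]
      exact Nat.odd_iff.1 hS
    · intro hS
      rw [hr]
      exact Nat.even_iff.1 (Nat.not_odd_iff_even.1 hS)

/-! ### The querying loop and the output loop -/

/-- The query logs that arise when an element satisfying `R` is queried repeatedly. -/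
inductive Reach (R : List (Fin n) → Fin n → Prop) : List (Fin n) → Prop
  | nil : Reach R []
  | cons {l : List (Fin n)} {x : Fin n} (hl : Reach R l) (hx : R l x) : Reach R (x :: l)

theorem Reach.nodup {R : List (Fin n) → Fin n → Prop} (hR : ∀ l x, R l x → x ∉ l)
    {l : List (Fin n)} (h : Reach R l) : l.Nodup := by
  induction h with
  | nil => exact List.nodup_nil
  | cons _ hx ih => exact List.nodup_cons.2 ⟨hR _ _ hx, ih⟩

/-- Query elements satisfying the formula `φ` (in variable `0`) as long as there are some. -/
def Prog.queryLoop (φ : Formula) : Prog :=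
  .forAll 4 0 (.forAll 2 0
    (.seq (φ.compile 1 0) (.ite (.natLt (.const 0) (.res 0)) (.query (.var 0)) .skip)))

theorem Exec.queryLoop {I : Input n} {w : Fin n → ℝ} {φ : Formula} (hφ : φ.closed 1 = true)
    {R : List (Fin n) → Fin n → Prop}
    (hR : ∀ l e, φ.Sat I w l 1 e ↔ R l (e 0)) (hlog : ∀ l x, R l x → x ∉ l)
    (s : State n) (hs : Reach R s.log) :
    ∃ s' t, Exec I w (.queryLoop φ) s s' t ∧ t ≤ n * (n * (φ.cost.eval n + 4) + 4) + 2 ∧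
      Reach R s'.log ∧ ∀ x, ¬ R s'.log x := by
  have body : ∀ i (hi : i < n) (s : State n), s.mem 2 0 = i →
      ∃ s' t, Exec I w (.seq (φ.compile 1 0)
          (.ite (.natLt (.const 0) (.res 0)) (.query (.var 0)) .skip)) s s' t ∧
        t ≤ φ.cost.eval n + 2 ∧ s'.mem 2 0 = i ∧ s'.mem 4 0 = s.mem 4 0 ∧
        ((R s.log ⟨i, hi⟩ ∧ s'.log = ⟨i, hi⟩ :: s.log) ∨
          (¬ R s.log ⟨i, hi⟩ ∧ s'.log = s.log)) := by
    intro i hi s h2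
    obtain ⟨s₁, t₁, h₁, ht₁, hA, h1, h0⟩ := φ.decides_compile I w 1 0 hφ s (fun _ => ⟨i, hi⟩)
      (by intro k hk; obtain rfl : k = 0 := by omega
          exact h2)
    simp only [hR] at h1 h0
    have hv : s₁.mem 2 0 = i := by rw [hA.2 2 0 (by simp) (by simp), h2]
    have h4 : s₁.mem 4 0 = s.mem 4 0 := hA.2 4 0 (by simp) (by simp)
    by_cases hx : R s.log ⟨i, hi⟩
    · refine ⟨⟨s₁.mem, ⟨i, hi⟩ :: s₁.log⟩, t₁ + (1 + 1), Exec.seq h₁ (Exec.ite_true ?_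
        (Exec.query _ _ ⟨i, hi⟩ hv)), by omega, hv, h4, Or.inl ⟨hx, by rw [hA.1]⟩⟩
      simp [Test.Holds, Expr.eval, Expr.res, h1 hx]
    · refine ⟨s₁, t₁ + (1 + 1), Exec.seq h₁ (Exec.ite_false ?_ (Exec.skip _)), by omega, hv, h4,
        Or.inr ⟨hx, hA.1⟩⟩
      simp [Test.Holds, Expr.eval, Expr.res, h0 hx]
  obtain ⟨s', t, h, ht, hl, hf⟩ := Exec.forAll (I := I) (w := w) 4 0 _ s
    (n * (φ.cost.eval n + 4) + 2)
    -- A full pass without a query certifies that nothing is left to query; every other pass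
    -- lengthens the log.
    (fun i s => Reach R s.log ∧ ((∀ x, ¬ R s.log x) ∨ i ≤ s.log.length))
    ⟨hs, Or.inr (Nat.zero_le _)⟩
    (by
      rintro i hi s ⟨hs, hp⟩ h4
      obtain ⟨s', t, h, ht, hl, h4', hp'⟩ := Exec.forAll (I := I) (w := w) 2 0 _ s
        (φ.cost.eval n + 2)
        (fun j s' => Reach R s'.log ∧ s'.mem 4 0 = i ∧
          ((s'.log = s.log ∧ ∀ x : Fin n, (x : ℕ) < j → ¬ R s.log x) ∨
            (s.log.length < s'.log.length ∧ ∃ x, R s.log x)))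
        ⟨hs, by simp [State.set_mem, h4], Or.inl ⟨rfl, by simp⟩⟩
        (by
          rintro j hj s₁ ⟨hl₁, h4₁, hp₁⟩ h2
          obtain ⟨s₂, t₂, h, ht, h2', h4₂, hc⟩ := body j hj s₁ h2
          refine ⟨s₂, t₂, h, ht, h2', ?_, ?_, ?_⟩
          · rw [State.set_log]
            rcases hc with ⟨hx, hc⟩ | ⟨-, hc⟩ <;> rw [hc]
            · exact hl₁.cons hx
            · exact hl₁
          · rw [State.set_mem, if_neg (by simp), h4₂, h4₁]
          · rw [State.set_log]
            rcases hc with ⟨hx, hc⟩ | ⟨hx, hc⟩ <;> rw [hc]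
            · right
              rcases hp₁ with ⟨he, -⟩ | ⟨hlt, hx'⟩
              · rw [he] at hx ⊢
                exact ⟨by simp, _, hx⟩
              · exact ⟨hlt.trans (by simp), hx'⟩
            · refine hp₁.imp_left fun ⟨he, hn⟩ => ⟨he, fun x hxj => ?_⟩
              rcases Nat.lt_succ_iff_lt_or_eq.1 hxj with h | h
              · exact hn x h
              · rw [← he, show x = ⟨j, hj⟩ from Fin.ext h]
                exact hx)
      refine ⟨s', t, h, by simpa [add_assoc] using ht, h4', by simpa using hl, ?_⟩
      rw [State.set_log]
      rcases hp' with ⟨he, hn⟩ | ⟨hlt, x, hx⟩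
      · left
        rw [he]
        exact fun x => hn x x.2
      · right
        rcases hp with hp | hp
        · exact absurd hx (hp x)
        · omega)
  refine ⟨s', t, h, by simpa [add_assoc] using ht, hl, ?_⟩
  rcases hf with hf | hf
  · exact hf
  -- The log already has length at least `n`, and querying `x` would give a longer list without
  -- repetitions.
  · intro x hx
    have := ((hl.cons hx).nodup hlog).length_le_card
    simp at this
    omega

/-- Write every element into array `0`, at the index given by the number of elements that precede
it according to the formula `φ` (variable `1` precedes variable `0`). -/
def Prog.outputLoop (φ : Formula) : Prog :=
  .forAll 2 0 (.seq (.accumulate 1 0 (φ.compile 2 1) (.add (.res 0) (.res 1)))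
    (.store 0 (.res 0) (.var 0)))

open Classical in
theorem Exec.outputLoop {I : Input n} {w : Fin n → ℝ} {φ : Formula} (hφ : φ.closed 2 = true)
    (s : State n) {B : Fin n → Fin n → Prop} (hB : ∀ e, φ.Sat I w s.log 2 e ↔ B (e 1) (e 0))
    (σ : Equiv.Perm (Fin n))
    (hσ : ∀ x, (Finset.univ.filter fun y => B y x).card = σ.symm x) :
    ∃ s' t, Exec I w (.outputLoop φ) s s' t ∧ t ≤ n * (n * (φ.cost.eval n + 3) + 6) + 2 ∧
      s'.log = s.log ∧ ∀ j : Fin n, s'.mem 0 j = σ j := by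
  obtain ⟨s', t, h, ht, hl, hf⟩ := Exec.forAll (I := I) (w := w) 2 0 _ s
    (n * (φ.cost.eval n + 3) + 4)
    (fun i s' => s'.log = s.log ∧ ∀ j : Fin n, (σ j : ℕ) < i → s'.mem 0 j = σ j)
    ⟨rfl, by simp⟩
    (by
      rintro i hi s₁ ⟨hl, hm⟩ h2
      obtain ⟨s₂, t₂, h, ht, hA, hr⟩ := (φ.decides_compile I w 2 1 hφ).accumulate
        (d := 1) (r := 0) (.add (.res 0) (.res 1))
        (fun c => c) rfl (by intro s c h h'; simp [Expr.eval, Expr.res, h, h'])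
        (by intro s c h h'; simp [Expr.eval, Expr.res, h, h']) s₁ (fun _ => ⟨i, hi⟩)
        (by intro k hk; obtain rfl : k = 0 := by omega
            exact h2)
      have hr' : s₂.mem 3 0 = σ.symm ⟨i, hi⟩ := by
        rw [hr, ← hσ, hl]
        congr 1
        ext y
        simp [hB]
      have h2' : s₂.mem 2 0 = i := by rw [hA.2 2 0 (by simp) (by simp), h2]
      have hst := Exec.store_set (I := I) (w := w) 0 (.res 0) (.var 0) s₂
      simp only [Expr.res, Expr.var, Expr.eval, hr', h2'] at hst
      refine ⟨_, _, Exec.seq h hst, by omega, by simp [State.set_mem, h2'], by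
        simp [hA.1, hl], ?_⟩
      intro j hj
      rw [State.set_mem, if_neg (by simp), State.set_mem]
      by_cases hji : (σ j : ℕ) = i
      · have : σ.symm ⟨i, hi⟩ = j := by rw [Equiv.symm_apply_eq]; exact Fin.ext hji.symm
        simp [this, hji]
      · have : ¬ (j : ℕ) = σ.symm ⟨i, hi⟩ := by
          intro h
          exact hji (by rw [Fin.ext h]; simp)
        rw [if_neg (by simp [this]), hA.2 0 j (by simp) (by simp), hm j (by omega)])
  exact ⟨s', t, h, by simpa [add_assoc] using ht, hl, fun j => hf j (σ j).2⟩

/-! ### Feasible query sets -/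

namespace Intervals

variable (I : Intervals n)

/-- The interval `x` is not a single point. -/
def Nontriv (x : Fin n) : Prop := I.lower x < I.upper x

/-- The number `v` lies strictly between the endpoints of the interval `x`. -/
def Inside (v : ℝ) (x : Fin n) : Prop := I.lower x < v ∧ v < I.upper x

/-- `x` and `y` are distinct intersecting non-trivial intervals. -/
def Adj (x y : Fin n) : Prop :=
  x ≠ y ∧ I.Nontriv x ∧ I.Nontriv y ∧ I.lower x < I.upper y ∧ I.lower y < I.upper x

variable {I}

theorem Adj.symm {x y : Fin n} (h : I.Adj x y) : I.Adj y x :=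
  ⟨h.1.symm, h.2.2.1, h.2.1, h.2.2.2.2, h.2.2.2.1⟩

theorem not_trivial_iff {x : Fin n} : ¬ I.Trivial x ↔ I.Nontriv x := by
  simp [Trivial, Nontriv, (I.lower_le_upper x).lt_iff_ne]

theorem Inside.nontriv {v : ℝ} {x : Fin n} (h : I.Inside v x) : I.Nontriv x := h.1.trans h.2

theorem Nontriv.ivl_eq {x : Fin n} (h : I.Nontriv x) :
    I.ivl x = Set.Ioo (I.lower x) (I.upper x) := if_neg h.ne

theorem IsRealization.inside {w : Fin n → ℝ} (hw : I.IsRealization w) {x : Fin n}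
    (h : I.Nontriv x) : I.Inside (w x) x := by
  have := hw x
  rwa [h.ivl_eq] at this

theorem mem_ivl_of_inside {v : ℝ} {x : Fin n} (h : I.Inside v x) : v ∈ I.ivl x := by
  rw [h.nontriv.ivl_eq]
  exact h

theorem IsRealization.eq_of_not_nontriv {w : Fin n → ℝ} (hw : I.IsRealization w) {x : Fin n}
    (h : ¬ I.Nontriv x) : w x = I.lower x ∧ w x = I.upper x := by
  have he : I.lower x = I.upper x := le_antisymm (I.lower_le_upper x) (not_lt.1 h)
  have := hw x
  rw [ivl, if_pos he] at this
  exact ⟨this, this.trans he⟩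

theorem IsRealization.mem_Icc {w : Fin n → ℝ} (hw : I.IsRealization w) (x : Fin n) :
    I.lower x ≤ w x ∧ w x ≤ I.upper x := by
  by_cases h : I.Nontriv x
  · exact ⟨(hw.inside h).1.le, (hw.inside h).2.le⟩
  · exact ⟨(hw.eq_of_not_nontriv h).1.ge, (hw.eq_of_not_nontriv h).2.le⟩

theorem adj_of_inside {w : Fin n → ℝ} (hw : I.IsRealization w) {x y : Fin n} (hxy : x ≠ y)
    (hx : I.Nontriv x) (h : I.Inside (w x) y) : I.Adj x y :=
  ⟨hxy, hx, h.nontriv, (hw.inside hx).1.trans h.2, h.1.trans (hw.inside hx).2⟩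

theorem adj_of_inside_inside {v : ℝ} {x y : Fin n} (hxy : x ≠ y) (hx : I.Inside v x)
    (hy : I.Inside v y) : I.Adj x y :=
  ⟨hxy, hx.nontriv, hy.nontriv, hx.1.trans hy.2, hy.1.trans hx.2⟩

/-- Two elements whose order is fixed cannot take values in both orders. -/
theorem Feasible.not_both_orders {w : Fin n → ℝ} {Q : Finset (Fin n)} (h : I.Feasible w Q)
    {x y : Fin n} {v v' : Fin n → ℝ} (hv : I.IsRealization v) (hv' : I.IsRealization v')
    (hvQ : ∀ i ∈ Q, v i = w i) (hvQ' : ∀ i ∈ Q, v' i = w i) (h₁ : v x < v y)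
    (h₂ : v' y < v' x) : False := by
  obtain ⟨σ, hσ⟩ := h
  rcases le_total (σ.symm x) (σ.symm y) with hle | hle
  · have := hσ v' hv' hvQ' hle
    simp at this
    exact absurd h₂ (not_lt.2 this)
  · have := hσ v hv hvQ hle
    simp at this
    exact absurd h₁ (not_lt.2 this)

theorem IsRealization.update {w : Fin n → ℝ} (hw : I.IsRealization w) {x : Fin n} {v : ℝ}
    (h : I.Inside v x) : I.IsRealization (Function.update w x v) := by
  intro i
  by_cases hi : i = x
  · subst hi
    simpa using mem_ivl_of_inside h
  · simpa [hi] using hw i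

/-- A feasible query set contains each interval that contains the value of another one. -/
theorem Feasible.mem_of_inside {w : Fin n → ℝ} (hw : I.IsRealization w) {Q : Finset (Fin n)}
    (h : I.Feasible w Q) {x y : Fin n} (hxy : x ≠ y) (hy : I.Inside (w x) y) : y ∈ Q := by
  by_contra hQ
  obtain ⟨a, ha₁, ha₂⟩ := exists_between hy.1
  obtain ⟨b, hb₁, hb₂⟩ := exists_between hy.2
  have hu : ∀ v, ∀ i ∈ Q, Function.update w y v i = w i := by
    intro v i hi
    rw [Function.update_of_ne]
    rintro rfl
    exact hQ hi
  refine h.not_both_orders (x := x) (y := y) (hw.update (x := y) (v := b) ⟨hy.1.trans hb₁, hb₂⟩)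
    (hw.update (x := y) (v := a) ⟨ha₁, ha₂.trans hy.2⟩) (hu b) (hu a) ?_ ?_
  · simpa [hxy] using hb₁
  · simpa [hxy] using ha₂

/-- A feasible query set is a vertex cover. -/
theorem Feasible.mem_or_mem {w : Fin n → ℝ} (hw : I.IsRealization w) {Q : Finset (Fin n)}
    (h : I.Feasible w Q) {x y : Fin n} (hxy : I.Adj x y) : x ∈ Q ∨ y ∈ Q := by
  by_contra! hQ
  obtain ⟨hne, hx, hy, h₁, h₂⟩ := hxy
  -- Move the value of `x` to a common point `a` of both intervals. As `x` is not in `Q`,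
  -- feasibility is unaffected, but now `y` is forced into `Q`.
  obtain ⟨a, ha₁, ha₂⟩ := exists_between (max_lt (lt_min hx h₁) (lt_min h₂ hy))
  have hxa : I.Inside a x := ⟨(le_max_left _ _).trans_lt ha₁, ha₂.trans_le (min_le_left _ _)⟩
  have hya : I.Inside a y := ⟨(le_max_right _ _).trans_lt ha₁, ha₂.trans_le (min_le_right _ _)⟩
  have hw' : I.IsRealization (Function.update w x a) := hw.update hxa
  have hf : I.Feasible (Function.update w x a) Q := by
    obtain ⟨σ, hσ⟩ := h
    refine ⟨σ, fun v hv hvQ => hσ v hv fun i hi => ?_⟩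
    rw [hvQ i hi, Function.update_of_ne]
    rintro rfl
    exact hQ.1 hi
  exact hQ.2 (hf.mem_of_inside hw' hne (by simpa using hya))

variable (I) in
/-- The left endpoint of the interval that remains after the elements of `Q` have been queried. -/
noncomputable def low (w : Fin n → ℝ) (Q : Set (Fin n)) (x : Fin n) : ℝ :=
  open Classical in if x ∈ Q then w x else I.lower x

variable (I) in
/-- The right endpoint of the interval that remains after the elements of `Q` have been queried. -/
noncomputable def high (w : Fin n → ℝ) (Q : Set (Fin n)) (x : Fin n) : ℝ :=
  open Classical in if x ∈ Q then w x else I.upper x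

variable (I) in
/-- After the elements of `Q` have been queried, no two remaining intervals overlap and none of
them contains a known value. -/
def Determined (w : Fin n → ℝ) (Q : Set (Fin n)) : Prop :=
  (∀ x y, I.Adj x y → x ∈ Q ∨ y ∈ Q) ∧
    ∀ x y, x ≠ y → x ∈ Q ∨ ¬ I.Nontriv x → I.Inside (w x) y → y ∈ Q

theorem low_le_high {w : Fin n → ℝ} {Q : Set (Fin n)} (x : Fin n) :
    I.low w Q x ≤ I.high w Q x := by
  unfold low high
  split_ifs
  · exact le_rfl
  · exact I.lower_le_upper x

theorem IsRealization.mem_Icc_low_high {w v : Fin n → ℝ} {Q : Set (Fin n)}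
    (hv : I.IsRealization v) (hvQ : ∀ i ∈ Q, v i = w i) (x : Fin n) :
    I.low w Q x ≤ v x ∧ v x ≤ I.high w Q x := by
  unfold low high
  split_ifs with h
  · exact ⟨(hvQ x h).ge, (hvQ x h).le⟩
  · exact hv.mem_Icc x

/-- If the order is determined, two remaining intervals do not overlap. -/
theorem Determined.high_le_low {w : Fin n → ℝ} (hw : I.IsRealization w) {Q : Set (Fin n)}
    (h : I.Determined w Q) {x y : Fin n} (hxy : x ≠ y) :
    I.high w Q x ≤ I.low w Q y ∨ I.high w Q y ≤ I.low w Q x := by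
  have key : ∀ x y, x ≠ y → x ∈ Q ∨ ¬ I.Nontriv x → y ∉ Q →
      I.high w Q x ≤ I.low w Q y ∨ I.high w Q y ≤ I.low w Q x := by
    intro x y hxy hx hy
    have hl : I.low w Q x = w x ∧ I.high w Q x = w x := by
      unfold low high
      split_ifs with hxQ
      · exact ⟨rfl, rfl⟩
      · have := hw.eq_of_not_nontriv (hx.resolve_left hxQ)
        exact ⟨this.1.symm, this.2.symm⟩
    have hly : I.low w Q y = I.lower y ∧ I.high w Q y = I.upper y := by
      simp [low, high, hy]
    rw [hl.1, hl.2, hly.1, hly.2]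
    by_contra! hc
    exact hy (h.2 x y hxy hx hc)
  by_cases hx : x ∈ Q
  · by_cases hy : y ∈ Q
    · simp only [low, high, hx, hy, if_true]
      exact le_total _ _
    · exact key x y hxy (Or.inl hx) hy
  · by_cases hy : y ∈ Q ∨ ¬ I.Nontriv y
    · exact (key y x hxy.symm hy hx).symm
    · push Not at hy
      by_cases hx' : I.Nontriv x
      · simp only [low, high, hx, hy.1, if_false]
        by_contra! hc
        rcases h.1 x y ⟨hxy, hx', hy.2, hc.2, hc.1⟩ with h' | h'
        · exact hx h'
        · exact hy.1 h'
      · exact key x y hxy (Or.inr hx') hy.1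

/-- If the order is determined, it is given by the endpoints of the remaining intervals. -/
theorem Determined.le_of_low_le {w v : Fin n → ℝ} (hw : I.IsRealization w) {Q : Set (Fin n)}
    (h : I.Determined w Q) (hv : I.IsRealization v) (hvQ : ∀ i ∈ Q, v i = w i) {x y : Fin n}
    (hxy : I.low w Q x < I.low w Q y ∨
      I.low w Q x = I.low w Q y ∧ I.high w Q x ≤ I.high w Q y) : v x ≤ v y := by
  by_cases hne : x = y
  · rw [hne]
  · have hx := hv.mem_Icc_low_high hvQ x
    have hy := hv.mem_Icc_low_high hvQ y
    have hy' := I.low_le_high (w := w) (Q := Q) y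
    rcases h.high_le_low hw hne with h | h
    · linarith
    · rcases hxy with hlt | ⟨heq, hle⟩
      · linarith
      · linarith

/-- Sort by remaining left endpoint, ties by right endpoint. The tie-break matters: a known value at
the left endpoint of an open interval has to precede it. -/
theorem Determined.feasible {w : Fin n → ℝ} (hw : I.IsRealization w) {Q : Finset (Fin n)}
    (h : I.Determined w Q) : I.Feasible w Q := by
  refine ⟨Tuple.sort fun x => toLex (I.low w Q x, I.high w Q x), fun v hv hvQ a b hab => ?_⟩
  have := Tuple.monotone_sort (fun x => toLex (I.low w Q x, I.high w Q x)) hab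
  simp only [Function.comp, Prod.Lex.toLex_le_toLex] at this
  exact h.le_of_low_le hw hv hvQ this

/-- If no other value lies in `y`, then querying everything except `y` already determines the order.
-/
theorem mem_mandatory_iff {w : Fin n → ℝ} (hw : I.IsRealization w) {y : Fin n} :
    y ∈ I.mandatory w ↔ ∃ x, x ≠ y ∧ I.Inside (w x) y := by
  constructor
  · intro hy
    by_contra! hc
    have hd : I.Determined w (Finset.univ.erase y : Finset (Fin n)) := by
      constructor
      · intro a b hab
        by_cases ha : a = y
        · right
          simp only [Finset.coe_erase, Set.mem_sdiff]
          exact ⟨by simp, fun hb => hab.1 (ha.trans (Set.mem_singleton_iff.1 hb).symm)⟩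
        · left
          simpa using ha
      · intro a b hab _ hin
        by_cases hb : b = y
        · subst hb
          exact absurd hin (hc a hab)
        · simpa using hb
    simpa using hy _ (hd.feasible hw)
  · rintro ⟨x, hxy, hx⟩ Q hQ
    exact hQ.mem_of_inside hw hxy hx

theorem exists_feasible_card_eq_opt (w : Fin n → ℝ) :
    ∃ Q : Finset (Fin n), I.Feasible w Q ∧ Q.card = I.opt w :=
  Nat.sInf_mem (s := {c | ∃ Q : Finset (Fin n), I.Feasible w Q ∧ Q.card = c})
    ⟨_, Finset.univ, I.feasible_univ w, rfl⟩

end Intervals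

/-! ### Comparison of mandatory distance and hop distance. -/

namespace Input

variable (I : Input n)

/-- If `i` is mandatory for only one of the two vectors, some `x` has exactly one of its value and
its prediction inside `i`, so it passes an endpoint of `i`. Jumps over trivial intervals are not
needed. -/
theorem mandatoryDist_le_hopDist {w : Fin n → ℝ} (hw : I.IsRealization w) :
    I.mandatoryDist w ≤ I.hopDist w := by
  classical
  have key : ∀ (u v : Fin n → ℝ) (i : Fin n), (∃ x, x ≠ i ∧ I.Inside (u x) i) →
      (¬ ∃ x, x ≠ i ∧ I.Inside (v x) i) → ∃ x, ¬ I.Trivial i ∧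
        ((u x ≤ I.lower i ∧ I.lower i < v x ∨ v x ≤ I.lower i ∧ I.lower i < u x) ∨
        (u x < I.upper i ∧ I.upper i ≤ v x ∨ v x < I.upper i ∧ I.upper i ≤ u x)) := by
    rintro u v i ⟨x, hx, hi⟩ hn
    refine ⟨x, Intervals.not_trivial_iff.2 hi.nontriv, ?_⟩
    have : ¬ I.Inside (v x) i := fun h => hn ⟨x, hx, h⟩
    simp only [Intervals.Inside] at this hi
    grind
  have hsub : symmDiff (I.mandatory I.pred) (I.mandatory w) ⊆
      ⋃ x ∈ (Finset.univ : Finset (Fin n)),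
        ({j | ¬ I.Trivial j ∧ PassesLower (w x) (I.pred x) (I.lower j)} ∪
        {j | ¬ I.Trivial j ∧ PassesUpper (w x) (I.pred x) (I.upper j)}) := by
    intro i hi
    simp only [Set.mem_symmDiff, Intervals.mem_mandatory_iff I.pred_mem,
      Intervals.mem_mandatory_iff hw] at hi
    simp only [Finset.mem_univ, Set.iUnion_true, Set.mem_iUnion, Set.mem_union, Set.mem_ofPred_eq,
      PassesLower, PassesUpper]
    rcases hi with ⟨h₁, h₂⟩ | ⟨h₁, h₂⟩
    · obtain ⟨x, ht, h⟩ := key _ _ i h₁ h₂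
      exact ⟨x, h.imp (fun h => ⟨ht, h.symm⟩) fun h => ⟨ht, h.symm⟩⟩
    · obtain ⟨x, ht, h⟩ := key _ _ i h₁ h₂
      exact ⟨x, h.imp (fun h => ⟨ht, h⟩) fun h => ⟨ht, h⟩⟩
  refine (Set.ncard_le_ncard hsub (Set.toFinite _)).trans ?_
  refine (Finset.set_ncard_biUnion_le _ _).trans (Finset.sum_le_sum fun x _ => ?_)
  exact (Set.ncard_union_le _ _).trans (Nat.le_add_right _ _)

end Input

/-! ### The query rule -/

namespace Intervals

variable (I : Intervals n)

/-- `x` contains another non-trivial interval. -/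
def Big (x : Fin n) : Prop :=
  ∃ j, j ≠ x ∧ I.Nontriv j ∧ I.lower x ≤ I.lower j ∧ I.upper j ≤ I.upper x

/-- A non-trivial interval that contains no other one. -/
def Proper (x : Fin n) : Prop := I.Nontriv x ∧ ¬ I.Big x

/-- No proper interval reaches `x` from the left. -/
def IsStart (x : Fin n) : Prop :=
  ∀ z, I.Proper z → I.lower z < I.lower x → ¬ I.lower x < I.upper z

/-- `z` is in the same component of proper intervals as `x`, and not to the right of `x`. -/
def Before (x z : Fin n) : Prop :=
  I.Proper z ∧ I.lower z ≤ I.lower x ∧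
    ∀ g, I.Proper g → I.IsStart g → ¬ (I.lower z < I.lower g ∧ I.lower g ≤ I.lower x)

open Classical in
/-- The position of `x` in its component of proper intervals, from left to right, is odd. -/
def OddPos (x : Fin n) : Prop := Odd (Finset.univ.filter fun z => I.Before x z).card

/-- `x` and `y` are not in `l`, and `x` is the only neighbour of `y` not in `l`. -/
def Leaf (l : List (Fin n)) (y x : Fin n) : Prop :=
  y ∉ l ∧ x ∉ l ∧ I.Adj y x ∧ ∀ z, z ∉ l → I.Adj y z → z = x

variable {I}

theorem Big.nontriv {x : Fin n} (h : I.Big x) : I.Nontriv x := by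
  obtain ⟨j, -, hj, h₁, h₂⟩ := h
  exact h₁.trans_lt (hj.trans_le h₂)

/-- Wherever the value of the inner interval is, it lies in `x`. -/
theorem Feasible.mem_of_big {w : Fin n → ℝ} (hw : I.IsRealization w) {Q : Finset (Fin n)}
    (h : I.Feasible w Q) {x : Fin n} (hx : I.Big x) : x ∈ Q := by
  obtain ⟨j, hne, hj, h₁, h₂⟩ := hx
  exact h.mem_of_inside hw hne
    ⟨h₁.trans_lt (hw.inside hj).1, (hw.inside hj).2.trans_le h₂⟩

end Intervals

/-! ### The rule and the history of leaf queries. -/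

namespace Input

variable (I : Input n)

/-- Another element is predicted to have its value in the interval `x`. -/
def PredHit (x : Fin n) : Prop := ∃ j, j ≠ x ∧ I.Inside (I.pred j) x

/-- `x` is certain or predicted to be mandatory, given the values of the elements of `l`. -/
def Urgent (w : Fin n → ℝ) (l : List (Fin n)) (x : Fin n) : Prop :=
  x ∉ l ∧ (I.Big x ∨ I.PredHit x ∨ ∃ j, j ∈ l ∧ j ≠ x ∧ I.Inside (w j) x)

/-- If nothing is urgent, then the neighbour `x` of a leaf `y` may be queried. Leaves in odd
position have priority. -/
def PairRule (w : Fin n → ℝ) (l : List (Fin n)) (x y : Fin n) : Prop :=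
  (¬ ∃ z, I.Urgent w l z) ∧ I.Leaf l y x ∧
    (I.OddPos y ∨ ¬ ∃ z y', I.OddPos y' ∧ I.Leaf l y' z)

/-- The elements `x` that may be queried after those in `l`. -/
def Rule (w : Fin n → ℝ) (l : List (Fin n)) (x : Fin n) : Prop :=
  I.Urgent w l x ∨ ∃ y, I.PairRule w l x y

/-- `x` was queried because of the leaf `y` in the course of the run with log `L`, after the
elements of `l`. -/
def PairAt (w : Fin n → ℝ) (L l : List (Fin n)) (x y : Fin n) : Prop :=
  x :: l <:+ L ∧ I.PairRule w l x y

variable {I} {w : Fin n → ℝ} {L l l' : List (Fin n)} {x x' y y' z : Fin n}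

theorem Rule.notMem (h : I.Rule w l x) : x ∉ l := by
  rcases h with h | ⟨y, h⟩
  · exact h.1
  · exact h.2.1.2.1

theorem Rule.nontriv (h : I.Rule w l x) : I.Nontriv x := by
  rcases h with ⟨-, h | ⟨j, -, h⟩ | ⟨j, -, -, h⟩⟩ | ⟨y, h⟩
  · exact h.nontriv
  · exact h.nontriv
  · exact h.nontriv
  · exact h.2.1.2.2.1.2.2.1

theorem nontriv_of_reach (h : Reach (I.Rule w) L) : ∀ x ∈ L, I.Nontriv x := by
  induction h with
  | nil => simp
  | cons _ hx ih =>
    intro y hy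
    rcases List.mem_cons.1 hy with rfl | hy
    · exact hx.nontriv
    · exact ih y hy

theorem exists_rule_of_mem (h : Reach (I.Rule w) L) :
    ∀ x ∈ L, ∃ l, x :: l <:+ L ∧ I.Rule w l x := by
  induction h with
  | nil => simp
  | @cons l' x' _ hx ih =>
    intro y hy
    rcases List.mem_cons.1 hy with rfl | hy
    · exact ⟨_, List.suffix_rfl, hx⟩
    · obtain ⟨l, hl, hr⟩ := ih y hy
      exact ⟨l, hl.trans (List.suffix_cons _ _), hr⟩

theorem suffix_total (h : l <:+ L) (h' : l' <:+ L) : l <:+ l' ∨ l' <:+ l :=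
  List.suffix_or_suffix_of_suffix h h'

/-- Of two elements of the log, if `x'` is not among those up to `x` then it came later. -/
theorem suffix_of_notMem (h : x :: l <:+ L) (h' : x' :: l' <:+ L) (hx : x' ∉ x :: l) :
    x :: l <:+ l' := by
  rcases suffix_total h h' with hs | hs
  · rcases List.suffix_cons_iff.1 hs with he | hs
    · rw [he] at hx
      simp at hx
    · exact hs
  · exact absurd (hs.subset (by simp)) hx

/-- A neighbour of the leaf `y` is queried before `x`, or equal to `x`. -/
theorem PairAt.mem_of_adj (h : I.PairAt w L l x y) (hz : I.Adj y z) : z ∈ x :: l := by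
  by_contra hc
  simp only [List.mem_cons, not_or] at hc
  exact hc.1 (h.2.2.1.2.2.2 z hc.2 hz)

theorem PairAt.ne (h : I.PairAt w L l x y) : y ≠ x := h.2.2.1.2.2.1.1

theorem PairAt.notMem_leaf (h : I.PairAt w L l x y) : y ∉ x :: l := by
  simp only [List.mem_cons, not_or]
  exact ⟨h.ne, h.2.2.1.1⟩

theorem not_predHit_of_notMem (h : ¬ ∃ z, I.Urgent w l z) (hx : x ∉ l) : ¬ I.PredHit x :=
  fun hp => h ⟨x, hx, Or.inr (Or.inl hp)⟩

theorem not_big_of_notMem (h : ¬ ∃ z, I.Urgent w l z) (hx : x ∉ l) : ¬ I.Big x :=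
  fun hp => h ⟨x, hx, Or.inl hp⟩

/-- Once `x` is queried, all neighbours of `y` are in the log, so `y` cannot later be the neighbour
of an unqueried leaf. -/
theorem PairAt.not_pairAt_leaf (h : I.PairAt w L l x y) : ¬ I.PairAt w L l' y y' := by
  intro h'
  have hs := suffix_of_notMem h.1 h'.1 h.notMem_leaf
  exact h'.2.2.1.1 (hs.subset (h.mem_of_adj h'.2.2.1.2.2.1.symm))

theorem PairAt.unique (h : I.PairAt w L l x y) (h' : I.PairAt w L l' x' y) : x = x' := by
  by_contra hne
  rcases suffix_total h.1 h'.1 with hs | hs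
  · rcases List.suffix_cons_iff.1 hs with he | hs
    · exact hne (List.cons_eq_cons.1 he).1
    · have := hs.subset (h.mem_of_adj h'.2.2.1.2.2.1)
      exact h'.2.2.1.2.1 this
  · rcases List.suffix_cons_iff.1 hs with he | hs
    · exact hne (List.cons_eq_cons.1 he).1.symm
    · have := hs.subset (h'.mem_of_adj h.2.2.1.2.2.1)
      exact h.2.2.1.2.1 this

/-- A leaf is queried only if its partner has its value there. -/
theorem PairAt.inside_of_mem (hw : I.IsRealization w) (hL : Reach (I.Rule w) L)
    (h : I.PairAt w L l x y) (hy : y ∈ L) : I.Inside (w x) y := by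
  obtain ⟨l', hl', hr⟩ := exists_rule_of_mem hL y hy
  have hs := suffix_of_notMem h.1 hl' h.notMem_leaf
  have hyl := h.2.2.1.1
  rcases hr with ⟨-, hb | hp | ⟨j, hj, hjy, hin⟩⟩ | ⟨y', hr⟩
  · exact absurd hb (not_big_of_notMem h.2.1 hyl)
  · exact absurd hp (not_predHit_of_notMem h.2.1 hyl)
  -- The element `j` whose value hits `y` is a neighbour of `y`, hence queried no later than `x`.
  -- Had it preceded `x`, then `y` would have been urgent.
  · have hjx : j ∈ x :: l := h.mem_of_adj
      (Intervals.adj_of_inside hw hjy (nontriv_of_reach hL j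
        (((List.suffix_cons _ _).trans hl').subset hj)) hin).symm
    rcases List.mem_cons.1 hjx with rfl | hjl
    · exact hin
    · exact absurd ⟨y, hyl, Or.inr (Or.inr ⟨j, hjl, hjy, hin⟩)⟩ h.2.1
  · exact absurd ⟨hl', hr⟩ h.not_pairAt_leaf

/-- Every queried element is mandatory, predicted to be mandatory or was queried with a leaf. -/
theorem inside_or_predHit_or_pairAt (hw : I.IsRealization w) (hL : Reach (I.Rule w) L)
    (hx : x ∈ L) :
    (∃ j, j ≠ x ∧ I.Inside (w j) x) ∨ I.PredHit x ∨ ∃ l y, I.PairAt w L l x y := by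
  obtain ⟨l, hl, hr⟩ := exists_rule_of_mem hL x hx
  rcases hr with ⟨-, ⟨j, hne, hj, h₁, h₂⟩ | hp | ⟨j, -, hjy, hin⟩⟩ | ⟨y, hr⟩
  · exact Or.inl ⟨j, hne, h₁.trans_lt (hw.inside hj).1, (hw.inside hj).2.trans_le h₂⟩
  · exact Or.inr (Or.inl hp)
  · exact Or.inl ⟨j, hjy, hin⟩
  · exact Or.inr (Or.inr ⟨l, y, hl, hr⟩)

/-! ### The number of queries in terms of the error -/

open Classical in
/-- Let `A` be the log and `Q` a feasible query set. An element queried with a leaf that is never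
queried is paid for by the leaf; the other elements of `A \ Q` are charged injectively to `E`. -/
theorem length_le_card_add_of_charge (hw : I.IsRealization w) (hL : Reach (I.Rule w) L)
    {Q : Finset (Fin n)} (hQ : I.Feasible w Q) (E : Finset (Fin n)) (f : Fin n → Fin n)
    (hf : ∀ x ∈ L, x ∉ Q → I.PredHit x ∨ (∃ l y, y ∈ L ∧ I.PairAt w L l x y) → f x ∈ E)
    (hinj : ∀ x ∈ L, ∀ x' ∈ L, x ∉ Q → x' ∉ Q →
      I.PredHit x ∨ (∃ l y, y ∈ L ∧ I.PairAt w L l x y) →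
      I.PredHit x' ∨ (∃ l y, y ∈ L ∧ I.PairAt w L l x' y) → f x = f x' → x = x') :
    L.length ≤ Q.card + E.card := by
  have hnd : L.Nodup := hL.nodup fun _ _ => Rule.notMem
  set A := L.toFinset with hA
  have hmem : ∀ x, x ∈ A ↔ x ∈ L := fun x => List.mem_toFinset
  set X := (A \ Q).filter fun x => I.PredHit x ∨ ∃ l y, y ∈ L ∧ I.PairAt w L l x y with hX
  set Y := (A \ Q).filter fun x => ∃ l y, y ∉ L ∧ I.PairAt w L l x y with hY
  have hsub : A \ Q ⊆ X ∪ Y := by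
    intro x hx
    have hx' := Finset.mem_sdiff.1 hx
    rcases inside_or_predHit_or_pairAt hw hL ((hmem x).1 hx'.1) with ⟨j, hne, hj⟩ | hp | ⟨l, y, hp⟩
    · exact absurd (hQ.mem_of_inside hw hne hj) hx'.2
    · exact Finset.mem_union_left _ (Finset.mem_filter.2 ⟨hx, Or.inl hp⟩)
    · by_cases hy : y ∈ L
      · exact Finset.mem_union_left _ (Finset.mem_filter.2 ⟨hx, Or.inr ⟨l, y, hy, hp⟩⟩)
      · exact Finset.mem_union_right _ (Finset.mem_filter.2 ⟨hx, ⟨l, y, hy, hp⟩⟩)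
  have hXE : X.card ≤ E.card := by
    refine Finset.card_le_card_of_injOn f ?_ ?_
    · intro x hx
      simp only [hX, Finset.coe_filter, Finset.mem_sdiff, hmem, Set.mem_ofPred_eq] at hx
      exact hf x hx.1.1 hx.1.2 hx.2
    · intro x hx x' hx' he
      simp only [hX, Finset.coe_filter, Finset.mem_sdiff, hmem, Set.mem_ofPred_eq] at hx hx'
      exact hinj x hx.1.1 x' hx'.1.1 hx.1.2 hx'.1.2 hx.2 hx'.2 he
  -- Map `x` to its leaf: unqueried by the definition of `Y`, and in the vertex cover `Q` because
  -- `x` is not.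
  have hYQ : Y.card ≤ (Q \ A).card := by
    have hp : ∀ x, ∃ y, x ∈ Y → y ∉ L ∧ ∃ l, I.PairAt w L l x y := by
      intro x
      by_cases hx : x ∈ Y
      · obtain ⟨l, y, hy, h⟩ := (Finset.mem_filter.1 hx).2
        exact ⟨y, fun _ => ⟨hy, l, h⟩⟩
      · exact ⟨x, fun h => absurd h hx⟩
    choose p hp using hp
    refine Finset.card_le_card_of_injOn p ?_ ?_
    · intro x hx
      obtain ⟨hy, l, h⟩ := hp x hx
      have hxQ := (Finset.mem_sdiff.1 (Finset.mem_filter.1 hx).1).2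
      simp only [Finset.coe_sdiff, Set.mem_sdiff, Finset.mem_coe, hmem]
      exact ⟨(hQ.mem_or_mem hw h.2.2.1.2.2.1).resolve_right hxQ, hy⟩
    · intro x hx x' hx' he
      obtain ⟨-, l, h⟩ := hp x hx
      obtain ⟨-, l', h'⟩ := hp x' hx'
      rw [← he] at h'
      exact h.unique h'
  have h₁ : A.card = L.length := List.toFinset_card_of_nodup hnd
  have h₂ := Finset.card_sdiff_add_card_inter A Q
  have h₃ := Finset.card_sdiff_add_card_inter Q A
  have h₄ := (Finset.card_le_card hsub).trans (Finset.card_union_le _ _)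
  rw [Finset.inter_comm Q A] at h₃
  omega

/-- If a prediction hits `x` outside `Q`, charge the element `s x` so predicted: a correct
prediction would force `x` into `Q`. Otherwise the leaf of `x` was queried, so the value of `x` lies
in it while its prediction does not; charge `x`. Elements with the same `s x` would be adjacent
outside `Q`, and the two kinds of charge differ because `s x` is in `Q`. -/
theorem length_le_card_add_numErrors (hw : I.IsRealization w) (hL : Reach (I.Rule w) L)
    {Q : Finset (Fin n)} (hQ : I.Feasible w Q) : L.length ≤ Q.card + I.numErrors w := by
  classical
  have hs : ∀ x, ∃ j, I.PredHit x → j ≠ x ∧ I.Inside (I.pred j) x := by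
    intro x
    by_cases hx : I.PredHit x
    · exact ⟨hx.choose, fun _ => hx.choose_spec⟩
    · exact ⟨x, fun h => absurd h hx⟩
  choose s hs using hs
  have key : ∀ x, x ∉ Q → I.PredHit x → w (s x) ≠ I.pred (s x) ∧ s x ∈ Q := by
    intro x hx hp
    obtain ⟨hne, hin⟩ := hs x hp
    have hw' : w (s x) ≠ I.pred (s x) := by
      intro he
      exact hx (hQ.mem_of_inside hw hne (he ▸ hin))
    refine ⟨hw', (hQ.mem_or_mem hw (Intervals.adj_of_inside I.pred_mem hne ?_ hin)).resolve_right
      hx⟩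
    by_contra hn
    exact hw' ((hw.eq_of_not_nontriv hn).1.trans (I.pred_mem.eq_of_not_nontriv hn).1.symm)
  have hpair : ∀ x ∈ L, ¬ I.PredHit x → (∃ l y, y ∈ L ∧ I.PairAt w L l x y) →
      w x ≠ I.pred x := by
    rintro x hx hp ⟨l, y, hy, h⟩ he
    exact not_predHit_of_notMem h.2.1 h.2.2.1.1
      ⟨x, h.ne.symm, he ▸ h.inside_of_mem hw hL hy⟩
  have := length_le_card_add_of_charge hw hL hQ (Finset.univ.filter fun i => w i ≠ I.pred i)
    (fun x => if I.PredHit x then s x else x) ?_ ?_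
  · rwa [numErrors, Set.ncard_eq_toFinset_card', Set.toFinset_ofPred]
  · intro x hx hxQ h
    simp only [Finset.mem_filter, Finset.mem_univ, true_and]
    split_ifs with hp
    · exact (key x hxQ hp).1
    · exact hpair x hx hp (h.resolve_left hp)
  · intro x hx x' hx' hxQ hxQ' h h' he
    split_ifs at he with hp hp' hp'
    · by_contra hne
      have h₁ := (hs x hp).2
      rw [he] at h₁
      rcases hQ.mem_or_mem hw
        (Intervals.adj_of_inside_inside hne h₁ (hs x' hp').2) with h | h
      · exact hxQ h
      · exact hxQ' h
    · exact absurd (he ▸ (key x hxQ hp).2) hxQ'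
    · exact absurd (he ▸ (key x' hxQ' hp').2) hxQ
    · exact he

/-- An element hit by a prediction and outside `Q` is mandatory only for the predictions; charge it.
In the other case charge the leaf, which is mandatory only for the true values. -/
theorem length_le_card_add_mandatoryDist (hw : I.IsRealization w) (hL : Reach (I.Rule w) L)
    {Q : Finset (Fin n)} (hQ : I.Feasible w Q) : L.length ≤ Q.card + I.mandatoryDist w := by
  classical
  have hp : ∀ x, ∃ y, (∃ l y, y ∈ L ∧ I.PairAt w L l x y) → y ∈ L ∧ ∃ l, I.PairAt w L l x y := by
    intro x
    by_cases hx : ∃ l y, y ∈ L ∧ I.PairAt w L l x y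
    · obtain ⟨l, y, hy, h⟩ := hx
      exact ⟨y, fun _ => ⟨hy, l, h⟩⟩
    · exact ⟨x, fun h => absurd h hx⟩
  choose p hp using hp
  have hnp : ∀ x, (∃ l y, y ∈ L ∧ I.PairAt w L l x y) → ¬ I.PredHit (p x) := by
    intro x hx
    obtain ⟨-, l, h⟩ := hp x hx
    exact not_predHit_of_notMem h.2.1 h.2.2.1.1
  have := length_le_card_add_of_charge hw hL hQ
    (Finset.univ.filter fun i => i ∈ symmDiff (I.mandatory I.pred) (I.mandatory w))
    (fun x => if I.PredHit x then x else p x) ?_ ?_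
  · rwa [mandatoryDist, Set.ncard_eq_toFinset_card', ← Set.filter_mem_univ_eq_toFinset]
  · intro x hx hxQ h
    simp only [Finset.mem_filter, Finset.mem_univ, true_and, Set.mem_symmDiff,
      Intervals.mem_mandatory_iff I.pred_mem]
    split_ifs with hpx
    · exact Or.inl ⟨hpx, fun hm => hxQ (hm Q hQ)⟩
    · have h := h.resolve_left hpx
      refine Or.inr ⟨(Intervals.mem_mandatory_iff hw).2 ?_, hnp x h⟩
      obtain ⟨hy, l, h⟩ := hp x h
      exact ⟨x, h.ne.symm, h.inside_of_mem hw hL hy⟩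
  · intro x hx x' hx' hxQ hxQ' h h' he
    split_ifs at he with hpx hpx' hpx'
    · exact he
    · exact absurd (he ▸ hpx) (hnp x' (h'.resolve_left hpx'))
    · exact absurd (he ▸ hpx') (hnp x (h.resolve_left hpx))
    · obtain ⟨-, l, h⟩ := hp x (h.resolve_left hpx)
      obtain ⟨-, l', h'⟩ := hp x' (h'.resolve_left hpx')
      rw [← he] at h'
      exact h.unique h'

end Input

/-! ### The order of the proper intervals -/

namespace Intervals

variable (I : Intervals n)

/-- `p` is the proper interval immediately to the left of `x`. -/
def IsPred (p x : Fin n) : Prop :=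
  I.Proper p ∧ I.lower p < I.lower x ∧ ∀ z, I.Proper z → I.lower z < I.lower x →
    I.lower z ≤ I.lower p

theorem wellFounded_lower : WellFounded fun a b : Fin n => I.lower a < I.lower b :=
  haveI : IsTrans (Fin n) fun a b => I.lower a < I.lower b := ⟨fun _ _ _ => lt_trans⟩
  haveI : Std.Irrefl fun a b : Fin n => I.lower a < I.lower b := ⟨fun _ => lt_irrefl _⟩
  Finite.wellFounded_of_trans_of_irrefl _

variable {I} {p x y z : Fin n}

/-- Otherwise `x` would contain `y`. Hence proper intervals have the same order by left and by right
endpoints. -/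
theorem Proper.upper_lt (hx : I.Proper x) (hy : I.Nontriv y) (hne : x ≠ y)
    (h : I.lower x ≤ I.lower y) : I.upper x < I.upper y := by
  by_contra! hc
  exact hx.2 ⟨y, hne.symm, hy, h, hc⟩

theorem Proper.upper_le (hx : I.Proper x) (hy : I.Nontriv y)
    (h : I.lower x ≤ I.lower y) : I.upper x ≤ I.upper y := by
  by_cases hne : x = y
  · rw [hne]
  · exact (hx.upper_lt hy hne h).le

theorem Proper.lower_ne (hx : I.Proper x) (hy : I.Proper y) (hne : x ≠ y) :
    I.lower x ≠ I.lower y := fun h =>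
  lt_asymm (hx.upper_lt hy.1 hne h.le) (hy.upper_lt hx.1 hne.symm h.ge)

theorem Proper.lower_lt_or_lt (hx : I.Proper x) (hy : I.Proper y) (hne : x ≠ y) :
    I.lower x < I.lower y ∨ I.lower y < I.lower x := lt_or_gt_of_ne (hx.lower_ne hy hne)

theorem Proper.adj_of_lt (hx : I.Proper x) (hy : I.Proper y) (h : I.lower x < I.lower y)
    (h' : I.lower y < I.upper x) : I.Adj x y :=
  ⟨fun e => h.ne (e ▸ rfl), hx.1, hy.1, h.trans hy.1, h'⟩

theorem exists_isPred (hz : I.Proper z) (h : I.lower z < I.lower x) : ∃ p, I.IsPred p x := by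
  classical
  obtain ⟨p, hp, hmax⟩ := Finset.exists_max_image
    (Finset.univ.filter fun z => I.Proper z ∧ I.lower z < I.lower x) I.lower ⟨z, by simp [hz, h]⟩
  simp only [Finset.mem_filter, Finset.mem_univ, true_and] at hp hmax
  exact ⟨p, hp.1, hp.2, fun z hz h => hmax z ⟨hz, h⟩⟩

theorem exists_isPred_adj (hz : I.Proper z) (h : I.lower z < I.lower x)
    (h' : I.lower x < I.upper z) : ∃ p, I.IsPred p x ∧ I.lower x < I.upper p := by
  obtain ⟨p, hp⟩ := exists_isPred hz h
  exact ⟨p, hp, h'.trans_le (hz.upper_le hp.1.1 (hp.2.2 z hz h))⟩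

theorem exists_isPred_of_not_isStart (h : ¬ I.IsStart x) :
    ∃ p, I.IsPred p x ∧ I.lower x < I.upper p := by
  simp only [IsStart, not_forall, not_not] at h
  obtain ⟨z, hz, h, h'⟩ := h
  exact exists_isPred_adj hz h h'

theorem Proper.before_self (hx : I.Proper x) : I.Before x x :=
  ⟨hx, le_rfl, fun _ _ _ h => absurd h.1 (not_lt.2 h.2)⟩

theorem before_iff_of_isStart (hx : I.Proper x) (h : I.IsStart x) :
    I.Before x z ↔ z = x := by
  constructor
  · rintro ⟨hz, hle, hg⟩
    by_contra hne
    exact hg x hx h ⟨lt_of_le_of_ne hle (hz.lower_ne hx hne), le_rfl⟩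
  · rintro rfl
    exact hx.before_self

theorem before_iff_of_isPred (hx : I.Proper x) (hp : I.IsPred p x) (h : I.lower x < I.upper p) :
    I.Before x z ↔ z = x ∨ I.Before p z := by
  constructor
  · rintro ⟨hz, hle, hg⟩
    by_cases hne : z = x
    · exact Or.inl hne
    · exact Or.inr ⟨hz, hp.2.2 z hz (lt_of_le_of_ne hle (hz.lower_ne hx hne)),
        fun g hg₁ hg₂ hc => hg g hg₁ hg₂ ⟨hc.1, hc.2.trans hp.2.1.le⟩⟩
  · rintro (rfl | ⟨hz, hle, hg⟩)
    · exact hx.before_self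
    · refine ⟨hz, hle.trans hp.2.1.le, fun g hg₁ hg₂ hc => ?_⟩
      by_cases hne : g = x
      · rw [hne] at hg₂
        exact hg₂ p hp.1 hp.2.1 h
      · exact hg g hg₁ hg₂ ⟨hc.1, hp.2.2 g hg₁ (lt_of_le_of_ne hc.2 (hg₁.lower_ne hx hne))⟩

theorem oddPos_of_isStart (hx : I.Proper x) (h : I.IsStart x) : I.OddPos x := by
  classical
  unfold OddPos
  rw [Finset.filter_congr fun z _ => before_iff_of_isStart hx h]
  simp [Finset.filter_eq']

/-- The elements counted for `x` are those counted for `p`, and `x` itself. -/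
theorem oddPos_iff_of_isPred (hx : I.Proper x) (hp : I.IsPred p x) (h : I.lower x < I.upper p) :
    I.OddPos x ↔ ¬ I.OddPos p := by
  classical
  unfold OddPos
  rw [Finset.filter_congr fun z _ => before_iff_of_isPred hx hp h, Finset.filter_or,
    Finset.filter_eq', if_pos (Finset.mem_univ _), ← Finset.insert_eq,
    Finset.card_insert_of_notMem, Nat.odd_add_one]
  simp only [Finset.mem_filter, Finset.mem_univ, true_and]
  exact fun hb => absurd hp.2.1 (not_lt.2 hb.2.1)

/-- Both intervals contain the left endpoint of `z`. -/
theorem adj_of_adj_left {a b : Fin n} (ha : I.Proper a) (hb : I.Proper b) (hne : a ≠ b)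
    (haz : I.Adj a z) (hbz : I.Adj b z) (hal : I.lower a < I.lower z)
    (hbl : I.lower b < I.lower z) : I.Adj a b :=
  ⟨hne, ha.1, hb.1, hal.trans hbz.2.2.2.2, hbl.trans haz.2.2.2.2⟩

theorem adj_of_adj_right {a b : Fin n} (ha : I.Proper a) (hb : I.Proper b) (hz : I.Proper z)
    (hne : a ≠ b) (haz : I.Adj a z) (hbz : I.Adj b z) (hal : I.lower z < I.lower a)
    (hbl : I.lower z < I.lower b) : I.Adj a b :=
  ⟨hne, ha.1, hb.1, haz.2.2.2.1.trans_le (hz.upper_le hb.1 hbl.le),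
    hbz.2.2.2.1.trans_le (hz.upper_le ha.1 hal.le)⟩

end Intervals

namespace Input

variable {I : Input n} {w : Fin n → ℝ} {L l l' : List (Fin n)} {p x x' y y' z : Fin n}

/-- Of three pairwise intersecting intervals, the middle one is covered by the others. -/
theorem predHit_of_triangle (hy : I.Proper y) (hxy : I.Adj x y) (hyz : I.Adj y z)
    (hxz : I.Adj x z) (h₁ : I.lower x ≤ I.lower y) (h₂ : I.lower y ≤ I.lower z) :
    I.PredHit x ∨ I.PredHit z := by
  have hin := I.pred_mem.inside hy.1
  by_cases h : I.pred y < I.upper x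
  · exact Or.inl ⟨y, hxy.1.symm, h₁.trans_lt hin.1, h⟩
  · refine Or.inr ⟨y, hyz.1, hxz.2.2.2.2.trans_le (not_lt.1 h), hin.2.trans_le ?_⟩
    exact hy.upper_le hyz.2.2.1 h₂

theorem no_triangle (hx : I.Proper x) (hy : I.Proper y) (hz : I.Proper z) (hx' : ¬ I.PredHit x)
    (hy' : ¬ I.PredHit y) (hz' : ¬ I.PredHit z) (hxy : I.Adj x y) (hyz : I.Adj y z)
    (hxz : I.Adj x z) : False := by
  rcases le_total (I.lower x) (I.lower y) with h₁ | h₁ <;>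
  rcases le_total (I.lower y) (I.lower z) with h₂ | h₂ <;>
  rcases le_total (I.lower x) (I.lower z) with h₃ | h₃
  · exact (predHit_of_triangle hy hxy hyz hxz h₁ h₂).elim hx' hz'
  · exact (predHit_of_triangle hy hxy hyz hxz h₁ h₂).elim hx' hz'
  · exact (predHit_of_triangle hz hxz hyz.symm hxy h₃ h₂).elim hx' hy'
  · exact (predHit_of_triangle hx hxz.symm hxy hyz.symm h₃ h₁).elim hz' hy'
  · exact (predHit_of_triangle hx hxy.symm hxz hyz h₁ h₃).elim hy' hz'
  · exact (predHit_of_triangle hz hyz hxz.symm hxy.symm h₂ h₃).elim hy' hx'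
  · exact (predHit_of_triangle hy hyz.symm hxy.symm hxz.symm h₂ h₁).elim hz' hx'
  · exact (predHit_of_triangle hy hyz.symm hxy.symm hxz.symm h₂ h₁).elim hz' hx'

/-- When no element satisfies the rule any more, the order is determined. -/
theorem determined_of_stuck (hw : I.IsRealization w) (h : ∀ x, ¬ I.Rule w L x) :
    I.Determined w {x | x ∈ L} := by
  classical
  have hu : ¬ ∃ z, I.Urgent w L z := fun ⟨z, hz⟩ => h z (Or.inl hz)
  constructor
  · by_contra! hc
    obtain ⟨a, b, hab, ha, hb⟩ := hc
    simp only [Set.mem_ofPred_eq] at ha hb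
    -- The leftmost unqueried element with an unqueried neighbour is a leaf: two such neighbours,
    -- both to its right, would form a triangle with it.
    obtain ⟨y, hy, hmin⟩ := Finset.exists_min_image
      (Finset.univ.filter fun y => y ∉ L ∧ ∃ x, x ∉ L ∧ I.Adj y x) I.lower
      ⟨a, by simpa using ⟨ha, b, hb, hab⟩⟩
    simp only [Finset.mem_filter, Finset.mem_univ, true_and] at hy hmin
    obtain ⟨hyL, x, hxL, hyx⟩ := hy
    have hproper : ∀ z, z ∉ L → I.Nontriv z → I.Proper z := fun z hz hz' =>
      ⟨hz', not_big_of_notMem hu hz⟩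
    have hleaf : I.Leaf L y x := by
      refine ⟨hyL, hxL, hyx, fun z hz hyz => ?_⟩
      by_contra hne
      have hy := hproper y hyL hyx.2.1
      have hx := hproper x hxL hyx.2.2.1
      have hz' := hproper z hz hyz.2.2.1
      have hxl := lt_of_le_of_ne (hmin x ⟨hxL, y, hyL, hyx.symm⟩) (hy.lower_ne hx hyx.1)
      have hzl := lt_of_le_of_ne (hmin z ⟨hz, y, hyL, hyz.symm⟩) (hy.lower_ne hz' hyz.1)
      exact no_triangle hy hz' hx (not_predHit_of_notMem hu hyL) (not_predHit_of_notMem hu hz)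
        (not_predHit_of_notMem hu hxL) hyz
        (Intervals.adj_of_adj_right hz' hx hy hne hyz.symm hyx.symm hzl hxl) hyx
    by_cases ho : ∃ z y', I.OddPos y' ∧ I.Leaf L y' z
    · obtain ⟨z, y', ho, hl⟩ := ho
      exact h z (Or.inr ⟨y', hu, hl, Or.inl ho⟩)
    · exact h x (Or.inr ⟨y, hu, hleaf, Or.inr ho⟩)
  · intro x y hne hx hin
    by_contra hy
    rcases hx with hx | hx
    · exact hu ⟨y, hy, Or.inr (Or.inr ⟨x, hx, hne, hin⟩)⟩
    · refine not_predHit_of_notMem hu hy ⟨x, hne, ?_⟩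
      rwa [(I.pred_mem.eq_of_not_nontriv hx).1, ← (hw.eq_of_not_nontriv hx).1]

/-! ### The number of queries is at most twice the optimum -/

variable {Q : Finset (Fin n)}

/-- In the part of the component of `x` up to `x`, all elements are queried, exactly those in even
position belong to `Q`, and no value of a non-proper element is predicted to be in an interval in
odd position. -/
def Tight (I : Input n) (L : List (Fin n)) (Q : Finset (Fin n)) (x : Fin n) : Prop :=
  ∀ s, I.Before x s → s ∈ L ∧ (s ∈ Q ↔ ¬ I.OddPos s) ∧
    (I.OddPos s → ∀ j, I.Big j → ¬ I.Inside (I.pred j) s)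

/-- No proper interval to the right of `x` meets `x`. -/
def IsLast (I : Input n) (x : Fin n) : Prop :=
  ∀ z, I.Proper z → I.lower x < I.lower z → ¬ I.lower z < I.upper x

/-- When `x` ends its component, the elements before `x` form the whole component and are closed
under proper neighbours. -/
theorem IsLast.before_of_adj (h : I.IsLast x) (hx : I.Proper x) (hs : I.Before x y)
    (hz : I.Proper z) (hyz : I.Adj y z) : I.Before x z := by
  obtain ⟨hy, hyx, hg⟩ := hs
  have hzx : I.lower z ≤ I.lower x := by
    by_contra! hc
    exact h z hz hc (hyz.2.2.2.2.trans_le (hy.upper_le hx.1 hyx))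
  refine ⟨hz, hzx, fun g hg₁ hg₂ hc => ?_⟩
  by_cases hgy : I.lower y < I.lower g
  · exact hg g hg₁ hg₂ ⟨hgy, hc.2⟩
  · exact hg₂ z hz hc.1 ((not_lt.1 hgy).trans_lt hyz.2.2.2.1)

theorem Tight.not_adj (h : I.Tight L Q x) (hw : I.IsRealization w) (hQ : I.Feasible w Q)
    (hy : I.Before x y) (hz : I.Before x z) (hyo : I.OddPos y) (hzo : I.OddPos z) :
    ¬ I.Adj y z := by
  intro hyz
  rcases hQ.mem_or_mem hw hyz with h' | h'
  · exact (h y hy).2.1.1 h' hyo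
  · exact (h z hz).2.1.1 h' hzo

theorem Tight.not_inside (h : I.Tight L Q x) (hw : I.IsRealization w) (hQ : I.Feasible w Q)
    (hy : I.Before x y) (hyo : I.OddPos y) (hz : z ≠ y) : ¬ I.Inside (w z) y :=
  fun hin => (h y hy).2.1.1 (hQ.mem_of_inside hw hz hin) hyo

/-- If a tight component ends in odd position, then not all its elements in odd position are
predicted to be mandatory. -/
theorem Tight.exists_not_predHit (h : I.Tight L Q x) (hw : I.IsRealization w)
    (hQ : I.Feasible w Q) (hx : I.Proper x) (hxo : I.OddPos x) (hlast : I.IsLast x) :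
    ∃ s, I.Before x s ∧ I.OddPos s ∧ ¬ I.PredHit s := by
  by_contra! hc
  have key : ∀ s, I.Before x s → I.OddPos s →
      ∃ j, I.Proper j ∧ I.lower s < I.lower j ∧ I.Inside (I.pred j) s := by
    intro s
    induction s using I.wellFounded_lower.induction with
    | _ s ih =>
      intro hs hso
      obtain ⟨j, hjs, hin⟩ := hc s hs hso
      -- A trivial `j` has its prediction as value, which would force `s` into `Q`; tightness
      -- excludes a `j` containing another interval.
      have hj : I.Proper j := by
        refine ⟨?_, fun hb => (h s hs).2.2 hso j hb hin⟩
        by_contra hn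
        refine h.not_inside hw hQ hs hso hjs ?_
        rwa [(hw.eq_of_not_nontriv hn).1, ← (I.pred_mem.eq_of_not_nontriv hn).1]
      have hadj := Intervals.adj_of_inside I.pred_mem hjs hj.1 hin
      have hjb := hlast.before_of_adj hx hs hj hadj.symm
      rcases hs.1.lower_lt_or_lt hj hjs.symm with hlt | hlt
      · exact ⟨j, hj, hlt, hin⟩
      exfalso
      -- With `j` to the left of `s`, the predecessor `p` of `j` is odd, and by induction `p` is hit
      -- from its right by some `j'`.
      have hje : ¬ I.OddPos j := fun hjo => h.not_adj hw hQ hjb hs hjo hso hadj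
      obtain ⟨p, hp, hpu⟩ := Intervals.exists_isPred_of_not_isStart
        fun hst => hje (Intervals.oddPos_of_isStart hj hst)
      have hpo : I.OddPos p := by
        by_contra hpo
        exact hje ((Intervals.oddPos_iff_of_isPred hj hp hpu).2 hpo)
      have hpj := hp.1.adj_of_lt hj hp.2.1 hpu
      have hpb := hlast.before_of_adj hx hjb hp.1 hpj.symm
      obtain ⟨j', hj', hpj', hin'⟩ := ih p (hp.2.1.trans hlt) hpb hpo
      have hadj' := Intervals.adj_of_inside I.pred_mem (by rintro rfl; exact lt_irrefl _ hpj') hj'.1 hin'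
      have hjb' := hlast.before_of_adj hx hpb hj' hadj'.symm
      have hje' : ¬ I.OddPos j' := fun ho => h.not_adj hw hQ hjb' hpb ho hpo hadj'
      by_cases hjj : j' = j
      · rw [hjj] at hin'
        refine h.not_adj hw hQ hpb hs hpo hso (Intervals.adj_of_inside_inside ?_ hin' hin)
        rintro rfl
        exact lt_asymm hlt hp.2.1
      · have hlt' : I.lower j < I.lower j' := by
          rcases hj.lower_lt_or_lt hj' (Ne.symm hjj) with h | h
          · exact h
          · exact absurd (hp.2.2 j' hj' h) (not_le.2 hpj')
        -- Since `j'` is even, its predecessor `q` is odd. It lies to the right of `p` and meets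
        -- `p`, although `Q` covers no edge between odd positions.
        obtain ⟨q, hq, hqu⟩ := Intervals.exists_isPred_adj hp.1 hpj' hadj'.2.2.2.1
        have hqo : I.OddPos q := by
          by_contra hqo
          exact hje' ((Intervals.oddPos_iff_of_isPred hj' hq hqu).2 hqo)
        have hpq : I.lower p < I.lower q := hp.2.1.trans_le (hq.2.2 j hj hlt')
        have hadjq := hp.1.adj_of_lt hq.1 hpq (hq.2.1.trans hadj'.2.2.2.1)
        exact h.not_adj hw hQ hpb (hlast.before_of_adj hx hpb hq.1 hadjq) hpo hqo hadjq
  obtain ⟨j, hj, hlt, hin⟩ := key x hx.before_self hxo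
  exact hlast j hj hlt ((I.pred_mem.inside hj.1).1.trans hin.2)

/-- Unqueried neighbours are in positions of different parity if nothing is urgent. -/
theorem oddPos_iff_of_adj (hu : ¬ ∃ z, I.Urgent w l z) (hx : I.Proper x) (hy : I.Proper y)
    (hxl : x ∉ l) (hyl : y ∉ l) (hxy : I.Adj x y) : I.OddPos x ↔ ¬ I.OddPos y := by
  have key : ∀ x y, I.Proper x → I.Proper y → x ∉ l → y ∉ l → I.Adj x y →
      I.lower x < I.lower y → (I.OddPos y ↔ ¬ I.OddPos x) := by
    intro x y hx hy hxl hyl hxy hlt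
    obtain ⟨p, hp, hpu⟩ := Intervals.exists_isPred_adj hx hlt hxy.2.2.2.2
    -- An interval `p` strictly between `x` and `y` would complete a triangle, and its prediction
    -- would hit `x` or `y`. This holds whether or not `p` was queried.
    have hpx : p = x := by
      by_contra hne
      have hxp : I.lower x < I.lower p :=
        lt_of_le_of_ne (hp.2.2 x hx hlt) (hx.lower_ne hp.1 (Ne.symm hne))
      rcases predHit_of_triangle hp.1
        (hx.adj_of_lt hp.1 hxp (hp.2.1.trans hxy.2.2.2.2)) (hp.1.adj_of_lt hy hp.2.1 hpu) hxy
        hxp.le hp.2.1.le with h | h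
      · exact not_predHit_of_notMem hu hxl h
      · exact not_predHit_of_notMem hu hyl h
    rw [hpx] at hp hpu
    exact Intervals.oddPos_iff_of_isPred hy hp hpu
  rcases hx.lower_lt_or_lt hy hxy.1 with h | h
  · rw [key x y hx hy hxl hyl hxy h, not_not]
  · exact key y x hy hx hyl hxl hxy.symm h

/-- A tight component ends in even position. -/
theorem Tight.not_oddPos (h : I.Tight L Q x) (hw : I.IsRealization w)
    (hL : Reach (I.Rule w) L) (hQ : I.Feasible w Q) (hx : I.Proper x) (hlast : I.IsLast x) :
    ¬ I.OddPos x := by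
  classical
  intro hxo
  -- Consider the earliest leaf query in the component. One exists: some odd element is hit by no
  -- prediction, and by no value since it is outside `Q`.
  obtain ⟨x₀, y₀, l, hp₀, hb₀, hmin⟩ : ∃ x₀ y₀ l, I.PairAt w L l x₀ y₀ ∧ I.Before x x₀ ∧
      ∀ x' y' l', I.PairAt w L l' x' y' → I.Before x x' → l.length ≤ l'.length := by
    have hex : ∃ m, ∃ x₀ y₀ l, I.PairAt w L l x₀ y₀ ∧ I.Before x x₀ ∧ l.length = m := by
      obtain ⟨s, hs, hso, hsp⟩ := h.exists_not_predHit hw hQ hx hxo hlast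
      rcases inside_or_predHit_or_pairAt hw hL (h s hs).1 with ⟨j, hj, hin⟩ | hp | ⟨l, y, hp⟩
      · exact absurd hin (h.not_inside hw hQ hs hso hj)
      · exact absurd hp hsp
      · exact ⟨_, s, y, l, hp, hs, rfl⟩
    obtain ⟨x₀, y₀, l, hp, hb, hl⟩ := Nat.find_spec hex
    exact ⟨x₀, y₀, l, hp, hb, fun x' y' l' hp' hb' =>
      hl ▸ Nat.find_min' hex ⟨x', y', l', hp', hb', rfl⟩⟩
  have hu := hp₀.2.1
  have hlL : l <:+ L := (List.suffix_cons _ _).trans hp₀.1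
  have hproper : ∀ z, z ∉ l → I.Nontriv z → I.Proper z := fun z hz hz' =>
    ⟨hz', not_big_of_notMem hu hz⟩
  have hph : ∀ z, z ∉ l → ¬ I.PredHit z := fun z => not_predHit_of_notMem hu
  have htri : ∀ a b c, a ∉ l → b ∉ l → c ∉ l → I.Adj a b → I.Adj b c → I.Adj a c → False :=
    fun a b c ha hb hc hab hbc hac => no_triangle (hproper a ha hab.2.1) (hproper b hb hab.2.2.1)
      (hproper c hc hac.2.2.1) (hph a ha) (hph b hb) (hph c hc) hab hbc hac
  have hnbr : ∀ a b, I.Before x a → a ∉ l → b ∉ l → I.Adj a b →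
      I.Proper b ∧ I.Before x b ∧ (I.OddPos a ↔ ¬ I.OddPos b) := by
    intro a b ha hal hbl hab
    have hb := hproper b hbl hab.2.2.1
    exact ⟨hb, hlast.before_of_adj hx ha hb hab, oddPos_iff_of_adj hu ha.1 hb hal hbl hab⟩
  have hpartner : ∀ z y' l', I.PairAt w L l' z y' → I.Before x z → y' ∉ l := by
    intro z y' l' hp hz hy'
    have hs : l <:+ l' := by
      rcases suffix_total hlL ((List.suffix_cons _ _).trans hp.1) with hs | hs
      · exact hs
      · rw [hs.eq_of_length (le_antisymm hs.length_le (hmin _ _ _ hp hz))]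
    exact hp.2.2.1.1 (hs.subset hy')
  have hodd : ∀ z, I.Before x z → I.OddPos z → z ∉ l → ∃ l' y', I.PairAt w L l' z y' := by
    intro z hz hzo hzl
    rcases inside_or_predHit_or_pairAt hw hL (h z hz).1 with ⟨j, hj, hin⟩ | hp | hp
    · exact absurd hin (h.not_inside hw hQ hz hzo hj)
    · exact absurd hp (hph z hzl)
    · exact hp
  have hy₀l := hp₀.2.2.1.1
  have hx₀l := hp₀.2.2.1.2.1
  have hadj₀ := hp₀.2.2.1.2.2.1
  obtain ⟨hy₀, hyb₀, hpar₀⟩ := hnbr x₀ y₀ hb₀ hx₀l hy₀l hadj₀.symm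
  -- Every odd element of the component still unqueried at `l` is later queried because of a leaf,
  -- which cannot happen to the leaf `y₀`.
  have hy₀e : ¬ I.OddPos y₀ := by
    intro ho
    obtain ⟨l', y', hp'⟩ := hodd y₀ hyb₀ ho hy₀l
    exact hp₀.not_pairAt_leaf hp'
  -- The priority rule enters here: choosing the even leaf `y₀` means that there was no odd leaf.
  have hnoleaf := hp₀.2.2.2.resolve_left hy₀e
  -- Not being a leaf, `z` has two unqueried neighbours; on the same side they would form a triangle
  -- with `z`.
  have hsides : ∀ z, I.Before x z → I.OddPos z → z ∉ l →
      (∃ a, a ∉ l ∧ I.Adj z a ∧ I.lower a < I.lower z) ∧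
      ∃ b, b ∉ l ∧ I.Adj z b ∧ I.lower z < I.lower b := by
    intro z hz hzo hzl
    obtain ⟨l', a, hp⟩ := hodd z hz hzo hzl
    have hal := hpartner z a l' hp hz
    have hza := hp.2.2.1.2.2.1.symm
    obtain ⟨b, hbl, hzb, hba⟩ : ∃ b, b ∉ l ∧ I.Adj z b ∧ b ≠ a := by
      by_contra! hc
      exact hnoleaf ⟨a, z, hzo, hzl, hal, hza, hc⟩
    have ha := hproper a hal hza.2.2.1
    have hb := hproper b hbl hzb.2.2.1
    rcases ha.lower_lt_or_lt hz.1 hza.1.symm with h₁ | h₁ <;>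
      rcases hb.lower_lt_or_lt hz.1 hzb.1.symm with h₂ | h₂
    · exact absurd (htri b a z hbl hal hzl (Intervals.adj_of_adj_left hb ha hba hzb.symm hza.symm
        h₂ h₁) hza.symm hzb.symm) id
    · exact ⟨⟨a, hal, hza, h₁⟩, b, hbl, hzb, h₂⟩
    · exact ⟨⟨b, hbl, hzb, h₂⟩, a, hal, hza, h₁⟩
    · exact absurd (htri b a z hbl hal hzl (Intervals.adj_of_adj_right hb ha hz.1 hba hzb.symm
        hza.symm h₂ h₁) hza.symm hzb.symm) id
  -- A leaf partner of `e` would be odd and so would itself need a leaf query, which is impossible.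
  -- Hence a value `j` falls into `e`. If `j` is to the left, it has a left neighbour `e'`, and the
  -- induction hypothesis for `e'` creates a triangle.
  have heven : ∀ e, I.Before x e → ¬ I.OddPos e → e ∉ l →
      ∃ j, j ∉ l ∧ I.Adj e j ∧ I.lower e < I.lower j ∧ I.Inside (w j) e := by
    intro e
    induction e using I.wellFounded_lower.induction with
    | _ e ih =>
      intro he hee hel
      rcases inside_or_predHit_or_pairAt hw hL (h e he).1 with ⟨j, hje, hin⟩ | hp | ⟨l', y', hp⟩
      · have hjl : j ∉ l := fun hjl => hu ⟨e, hel, Or.inr (Or.inr ⟨j, hjl, hje, hin⟩)⟩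
        have hjn : I.Nontriv j := by
          by_contra hn
          refine hph e hel ⟨j, hje, ?_⟩
          rwa [(I.pred_mem.eq_of_not_nontriv hn).1, ← (hw.eq_of_not_nontriv hn).1]
        have hadj := Intervals.adj_of_inside hw hje hjn hin
        obtain ⟨hj, hjb, hpar⟩ := hnbr e j he hel hjl hadj.symm
        have hjo : I.OddPos j := by
          by_contra hjo
          exact hee (hpar.2 hjo)
        rcases he.1.lower_lt_or_lt hj hje.symm with hlt | hlt
        · exact ⟨j, hjl, hadj.symm, hlt, hin⟩
        exfalso
        obtain ⟨⟨e', hel', hje', hlt'⟩, -⟩ := hsides j hjb hjo hjl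
        obtain ⟨he', heb', hpar'⟩ := hnbr j e' hjb hjl hel' hje'
        obtain ⟨j', hjl', hadj', hlt'', hin'⟩ :=
          ih e' (hlt'.trans hlt) heb' (hpar'.1 hjo) hel'
        by_cases hjj : j' = j
        · rw [hjj] at hin'
          have hne : e' ≠ e := by
            rintro rfl
            exact lt_asymm hlt hlt'
          exact htri e' j e hel' hjl hel hje'.symm hadj
            (Intervals.adj_of_inside_inside hne hin' hin)
        · have hj' := hproper j' hjl' hadj'.2.2.1
          exact htri e' j' j hel' hjl' hjl hadj' (Intervals.adj_of_adj_right hj' hj he' hjj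
            hadj'.symm hje' hlt'' hlt') hje'.symm
      · exact absurd hp (hph e hel)
      · have hyl := hpartner e y' l' hp he
        obtain ⟨hy', hyb', hpar⟩ := hnbr e y' he hel hyl hp.2.2.1.2.2.1.symm
        have hyo : I.OddPos y' := by
          by_contra hyo
          exact hee (hpar.2 hyo)
        obtain ⟨l'', y'', hp''⟩ := hodd y' hyb' hyo hyl
        exact absurd hp'' hp.not_pairAt_leaf
  -- In either parity the rightmost unqueried element of the component has an unqueried neighbour
  -- further right.
  obtain ⟨m, hm, hmax⟩ := Finset.exists_max_image
    (Finset.univ.filter fun z => I.Before x z ∧ z ∉ l) I.lower ⟨x₀, by simp [hb₀, hx₀l]⟩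
  simp only [Finset.mem_filter, Finset.mem_univ, true_and] at hm hmax
  obtain ⟨r, hrl, hmr, hlt⟩ : ∃ r, r ∉ l ∧ I.Adj m r ∧ I.lower m < I.lower r := by
    by_cases hmo : I.OddPos m
    · exact (hsides m hm.1 hmo hm.2).2
    · obtain ⟨r, hrl, hmr, hlt, -⟩ := heven m hm.1 hmo hm.2
      exact ⟨r, hrl, hmr, hlt⟩
  exact absurd (hmax r ⟨(hnbr m r hm.1 hm.2 hrl hmr).2.1, hrl⟩) (not_le.2 hlt)

end Input

/-! ### Left-to-right count over the proper intervals. -/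

namespace Input

variable {I : Input n} {w : Fin n → ℝ} {L : List (Fin n)} {Q : Finset (Fin n)} {p x : Fin n}

open Classical in
/-- The number of proper intervals with property `P` up to `x`, from the left. -/
noncomputable def countUpTo (I : Input n) (P : Fin n → Prop) (x : Fin n) : ℕ :=
  (Finset.univ.filter fun z => I.Proper z ∧ I.lower z ≤ I.lower x ∧ P z).card

open Classical in
/-- The number of non-proper intervals whose predicted value is in an interval in odd position
up to `x`. -/
noncomputable def spareUpTo (I : Input n) (x : Fin n) : ℕ :=
  (Finset.univ.filter fun j => I.Big j ∧
    ∃ s, I.Proper s ∧ I.lower s ≤ I.lower x ∧ I.OddPos s ∧ I.Inside (I.pred j) s).card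

open Classical in
theorem countUpTo_of_isPred (P : Fin n → Prop) (hx : I.Proper x) (hp : I.IsPred p x) :
    I.countUpTo P x = I.countUpTo P p + if P x then 1 else 0 := by
  have h : (Finset.univ.filter fun z => I.Proper z ∧ I.lower z ≤ I.lower x ∧ P z) =
      (Finset.univ.filter fun z => I.Proper z ∧ I.lower z ≤ I.lower p ∧ P z) ∪
        (if P x then {x} else ∅) := by
    ext z
    by_cases hz : z = x
    · subst hz
      split_ifs with hP <;> simp [hx, hP]
    · have : I.Proper z → (I.lower z ≤ I.lower x ↔ I.lower z ≤ I.lower p) := fun hz' =>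
        ⟨fun h => hp.2.2 z hz' (lt_of_le_of_ne h (hz'.lower_ne hx hz)),
          fun h => h.trans hp.2.1.le⟩
      split_ifs <;> simp [hz] <;> grind
  unfold countUpTo
  rw [h, Finset.card_union_of_disjoint]
  · split_ifs <;> simp
  · rw [Finset.disjoint_left]
    intro z hz
    simp only [Finset.mem_filter, Finset.mem_univ, true_and] at hz
    split_ifs
    · simp only [Finset.mem_singleton]
      rintro rfl
      exact absurd hp.2.1 (not_lt.2 hz.2.1)
    · simp

open Classical in
theorem countUpTo_of_min (P : Fin n → Prop) (hx : I.Proper x) (hmin : ¬ ∃ p, I.IsPred p x) :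
    I.countUpTo P x = if P x then 1 else 0 := by
  have h : ∀ z, (I.Proper z ∧ I.lower z ≤ I.lower x ∧ P z) ↔ (z = x ∧ P x) := by
    intro z
    constructor
    · rintro ⟨hz, hle, hP⟩
      by_cases hzx : z = x
      · exact ⟨hzx, hzx ▸ hP⟩
      · exact absurd (Intervals.exists_isPred hz (lt_of_le_of_ne hle (hz.lower_ne hx hzx))) hmin
    · rintro ⟨rfl, hP⟩
      exact ⟨hx, le_rfl, hP⟩
  unfold countUpTo
  rw [Finset.filter_congr fun z _ => h z]
  split_ifs with hP <;> simp [hP, Finset.filter_eq']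

theorem spareUpTo_mono (h : I.lower p ≤ I.lower x) : I.spareUpTo p ≤ I.spareUpTo x := by
  classical
  refine Finset.card_le_card fun j => ?_
  simp only [Finset.mem_filter, Finset.mem_univ, true_and]
  rintro ⟨hj, s, hs, hsp, h'⟩
  exact ⟨hj, s, hs, hsp.trans h, h'⟩

/-- The last hypothesis makes `j` a new spare unit, not counted up to `p`. -/
theorem spareUpTo_lt {j s : Fin n} (h : I.lower p ≤ I.lower x) (hj : I.Big j) (hs : I.Proper s)
    (hsx : I.lower s ≤ I.lower x) (hso : I.OddPos s) (hin : I.Inside (I.pred j) s)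
    (hn : ∀ s, I.Proper s → I.lower s ≤ I.lower p → I.OddPos s → ¬ I.Inside (I.pred j) s) :
    I.spareUpTo p + 1 ≤ I.spareUpTo x := by
  classical
  refine Finset.card_lt_card (Finset.ssubset_iff_of_subset ?_ |>.2 ⟨j, ?_, ?_⟩)
  · intro j
    simp only [Finset.mem_filter, Finset.mem_univ, true_and]
    rintro ⟨hj, s, hs, hsp, h'⟩
    exact ⟨hj, s, hs, hsp.trans h, h'⟩
  · simpa using ⟨hj, s, hs, hsx, hso, hin⟩
  · simp only [Finset.mem_filter, Finset.mem_univ, true_and]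
    rintro ⟨-, s, hs, hsp, hso, hin⟩
    exact hn s hs hsp hso hin

theorem spareUpTo_pos {j : Fin n} (hj : I.Big j) (hx : I.Proper x)
    (hxo : I.OddPos x) (hin : I.Inside (I.pred j) x) : 1 ≤ I.spareUpTo x :=
  Finset.card_pos.2 ⟨j, by simpa using ⟨hj, x, hx, le_rfl, hxo, hin⟩⟩

theorem Tight.mem_of_isLast (h : I.Tight L Q x) (hw : I.IsRealization w)
    (hL : Reach (I.Rule w) L) (hQ : I.Feasible w Q) (hx : I.Proper x) (hlast : I.IsLast x) :
    x ∈ Q :=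
  (h x hx.before_self).2.1.2 (h.not_oddPos hw hL hQ hx hlast)

theorem tight_of_isStart (hx : I.Proper x) (hst : I.IsStart x) (hxL : x ∈ L) (hxQ : x ∉ Q)
    (hb : ∀ j, I.Big j → ¬ I.Inside (I.pred j) x) : I.Tight L Q x := by
  intro s hs
  rw [Intervals.before_iff_of_isStart hx hst] at hs
  subst hs
  have := Intervals.oddPos_of_isStart hx hst
  exact ⟨hxL, by simp [hxQ, this], fun _ => hb⟩

theorem Tight.of_isPred (h : I.Tight L Q p) (hx : I.Proper x) (hp : I.IsPred p x)
    (hpx : I.lower x < I.upper p) (hxL : x ∈ L) (hxQ : x ∈ Q ↔ ¬ I.OddPos x)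
    (hb : I.OddPos x → ∀ j, I.Big j → ¬ I.Inside (I.pred j) x) : I.Tight L Q x := by
  intro s hs
  rcases (Intervals.before_iff_of_isPred hx hp hpx).1 hs with rfl | hs
  · exact ⟨hxL, hxQ, hb⟩
  · exact h s hs

open Classical in
/-- The number of queried elements, compared with a feasible query set from left to right. -/
theorem count_le (hw : I.IsRealization w) (hL : Reach (I.Rule w) L) (hQ : I.Feasible w Q)
    (x : Fin n) (hx : I.Proper x) :
    I.countUpTo (· ∈ L) x + (if x ∈ Q then 1 else 0) ≤
      2 * I.countUpTo (· ∈ Q) x + I.spareUpTo x + if I.Tight L Q x then 1 else 0 := by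
  induction x using I.wellFounded_lower.induction with
  | _ x ih =>
    by_cases hmin : ∃ p, I.IsPred p x
    · obtain ⟨p, hp⟩ := hmin
      have ihp := ih p hp.2.1 hp.1
      have hmono := spareUpTo_mono (I := I) hp.2.1.le
      rw [countUpTo_of_isPred _ hx hp, countUpTo_of_isPred _ hx hp]
      by_cases hpx : I.lower x < I.upper p
      · have hadj := hp.1.adj_of_lt hx hp.2.1 hpx
        by_cases hxQ : x ∈ Q
        -- Passing to `x` adds at most two on the left and exactly two on the right. Only a
        -- tightness unit at `p` must be carried on, and if `p ∈ Q` the unit dropped on the left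
        -- replaces it.
        · have : I.Tight L Q p → p ∉ Q → x ∈ L → I.Tight L Q x := by
            intro ht hpQ hxL
            have hpo : I.OddPos p := by
              by_contra hpo
              exact hpQ ((ht p hp.1.before_self).2.1.2 hpo)
            have hxo : ¬ I.OddPos x := fun ho =>
              (Intervals.oddPos_iff_of_isPred hx hp hpx).1 ho hpo
            exact ht.of_isPred hx hp hpx hxL (by simp [hxQ, hxo]) fun ho => absurd ho hxo
          split_ifs at * <;> first | omega | tauto
        · have hpQ : p ∈ Q := (hQ.mem_or_mem hw hadj).resolve_right hxQ
          have : I.Tight L Q p → x ∈ L → ¬ I.Tight L Q x →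
              I.spareUpTo p + 1 ≤ I.spareUpTo x := by
            intro ht hxL hnt
            have hxo : I.OddPos x := (Intervals.oddPos_iff_of_isPred hx hp hpx).2
              ((ht p hp.1.before_self).2.1.1 hpQ)
            obtain ⟨j, hj, hin⟩ : ∃ j, I.Big j ∧ I.Inside (I.pred j) x := by
              by_contra! hc
              exact hnt (ht.of_isPred hx hp hpx hxL (by simp [hxQ, hxo]) fun _ => hc)
            -- An earlier odd `s` hit by the same prediction would meet `x`, so lie in its
            -- component, and the edge would be uncovered by `Q`.
            refine spareUpTo_lt hp.2.1.le hj hx le_rfl hxo hin fun s hs hsp hso hin' => ?_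
            have hsx : s ≠ x := by
              rintro rfl
              exact absurd hp.2.1 (not_lt.2 hsp)
            have hadj' := Intervals.adj_of_inside_inside hsx hin' hin
            have hsb : I.Before p s := by
              refine ⟨hs, hsp, fun g hg hst hc => ?_⟩
              exact hst s hs hc.1 (hc.2.trans_lt (hp.2.1.trans hadj'.2.2.2.2))
            exact (hQ.mem_or_mem hw hadj').elim (fun h => (ht s hsb).2.1.1 h hso) hxQ
          simp only [hxQ, hpQ, if_true, if_false] at *
          split_ifs at * <;> first | omega | tauto | grind
      · have hst : I.IsStart x := fun z hz hzx hc =>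
          hpx (hc.trans_le (hz.upper_le hp.1.1 (hp.2.2 z hz hzx)))
        have hxo := Intervals.oddPos_of_isStart hx hst
        have hlast : I.IsLast p := by
          intro z hz hpz hc
          rcases eq_or_ne z x with rfl | hne
          · exact hpx hc
          · rcases hz.lower_lt_or_lt hx hne with h | h
            · exact absurd (hp.2.2 z hz h) (not_le.2 hpz)
            · exact hpx (h.trans hc)
        -- The component ends at `p`: a tightness unit there cancels against the unit for `p ∈ Q`,
        -- so no debt enters the next component.
        have hpt : I.Tight L Q p → p ∈ Q := fun ht => ht.mem_of_isLast hw hL hQ hp.1 hlast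
        have : x ∈ L → x ∉ Q → ¬ I.Tight L Q x → I.spareUpTo p + 1 ≤ I.spareUpTo x := by
          intro hxL hxQ hnt
          obtain ⟨j, hj, hin⟩ : ∃ j, I.Big j ∧ I.Inside (I.pred j) x := by
            by_contra! hc
            exact hnt (tight_of_isStart hx hst hxL hxQ hc)
          refine spareUpTo_lt hp.2.1.le hj hx le_rfl hxo hin fun s hs hsp _ hin' => ?_
          exact hst s hs (hsp.trans_lt hp.2.1) (hin.1.trans hin'.2)
        split_ifs at * <;> first | omega | tauto | grind
    · rw [countUpTo_of_min _ hx hmin, countUpTo_of_min _ hx hmin]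
      have hst : I.IsStart x := fun z hz hzx _ => hmin (Intervals.exists_isPred hz hzx)
      have : x ∈ L → x ∉ Q → ¬ I.Tight L Q x → 1 ≤ I.spareUpTo x := by
        intro hxL hxQ hnt
        obtain ⟨j, hj, hin⟩ : ∃ j, I.Big j ∧ I.Inside (I.pred j) x := by
          by_contra! hc
          exact hnt (tight_of_isStart hx hst hxL hxQ hc)
        exact spareUpTo_pos hj hx (Intervals.oddPos_of_isStart hx hst) hin
      split_ifs <;> first | omega | tauto | grind

/-- Apply `count_le` at the rightmost proper interval. The intervals containing another one form
`B`, all of it inside `Q`; they cost at most one unit each as queries and at most one as spares. -/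
theorem length_le_two_mul_card (hw : I.IsRealization w) (hL : Reach (I.Rule w) L)
    (hQ : I.Feasible w Q) : L.length ≤ 2 * Q.card := by
  classical
  set B := Finset.univ.filter fun x => I.Big x with hB
  set A' := Finset.univ.filter fun x => I.Proper x ∧ x ∈ L with hA'
  set Q' := Finset.univ.filter fun x => I.Proper x ∧ x ∈ Q with hQ'
  have h₁ : L.length ≤ A'.card + B.card := by
    rw [← List.toFinset_card_of_nodup (hL.nodup fun _ _ => Rule.notMem)]
    refine (Finset.card_le_card fun x hx => ?_).trans (Finset.card_union_le _ _)
    have hxL := List.mem_toFinset.1 hx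
    have hxn := nontriv_of_reach hL x hxL
    by_cases hb : I.Big x
    · simp [hB, hb]
    · exact Finset.mem_union_left _ (Finset.mem_filter.2 ⟨Finset.mem_univ _, ⟨hxn, hb⟩, hxL⟩)
  have h₂ : Q'.card + B.card ≤ Q.card := by
    rw [← Finset.card_union_of_disjoint]
    · refine Finset.card_le_card fun x hx => ?_
      rcases Finset.mem_union.1 hx with hx | hx
      · exact (Finset.mem_filter.1 hx).2.2
      · exact hQ.mem_of_big hw (Finset.mem_filter.1 hx).2
    · rw [Finset.disjoint_left]
      intro x hx hx'
      exact (Finset.mem_filter.1 hx).2.1.2 (Finset.mem_filter.1 hx').2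
  have h₃ : A'.card ≤ 2 * Q'.card + B.card := by
    by_cases hne : ∃ x, I.Proper x
    · obtain ⟨x₁, hx₁⟩ := hne
      obtain ⟨x, hx, hmax⟩ := Finset.exists_max_image (Finset.univ.filter fun x => I.Proper x)
        I.lower ⟨x₁, by simpa using hx₁⟩
      simp only [Finset.mem_filter, Finset.mem_univ, true_and] at hx hmax
      have hc : ∀ (P : Fin n → Prop) (S : Finset (Fin n)), (∀ z, z ∈ S ↔ I.Proper z ∧ P z) →
          I.countUpTo P x = S.card := by
        intro P S hS
        unfold countUpTo
        congr 1
        ext z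
        simp only [Finset.mem_filter, Finset.mem_univ, true_and, hS]
        exact ⟨fun h => ⟨h.1, h.2.2⟩, fun h => ⟨h.1, hmax z h.1, h.2⟩⟩
      have hs : I.spareUpTo x ≤ B.card := by
        refine Finset.card_le_card fun j hj => ?_
        simp only [Finset.mem_filter, Finset.mem_univ, true_and, hB] at hj ⊢
        exact hj.1
      have hcount := count_le hw hL hQ x hx
      rw [hc _ A' (by simp [hA']), hc _ Q' (by simp [hQ'])] at hcount
      have ht : I.Tight L Q x → x ∈ Q := fun ht => ht.mem_of_isLast hw hL hQ hx
        fun z hz hlt _ => absurd (hmax z hz) (not_le.2 hlt)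
      split_ifs at hcount <;> first | omega | tauto
    · have : A' = ∅ := Finset.filter_false_of_mem fun x _ h => hne ⟨x, h.1⟩
      simp [this]
  omega

end Input

/-! ### The rule and the final order as formulas -/

namespace Formula

/-- Disjunction. -/
def or (φ ψ : Formula) : Formula := .not (.and (.not φ) (.not ψ))

/-- The variables `x` and `y` stand for different elements. -/
def ne (x y : ℕ) : Formula := or (.idxLt x y) (.idxLt y x)

/-- `Intervals.Nontriv` for variable `x`. -/
def nontriv (x : ℕ) : Formula := .lt (.lower x) (.upper x)

/-- The element `x` has been queried, if it is non-trivial. -/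
def queried (x : ℕ) : Formula := .lt (.lower x) (.value x)

/-- `x` is non-trivial and has not been queried. -/
def unqueried (x : ℕ) : Formula := .and (.nontriv x) (.not (.queried x))

/-- `Intervals.Adj` for variables `x` and `y`. -/
def adj (x y : ℕ) : Formula :=
  .and (ne x y) (.and (nontriv x) (.and (nontriv y)
    (.and (.lt (.lower x) (.upper y)) (.lt (.lower y) (.upper x)))))

/-- `Intervals.Big` for variable `x` in scope `d`. -/
def big (d x : ℕ) : Formula :=
  .ex (.and (ne d x) (.and (nontriv d)
    (.and (.not (.lt (.lower d) (.lower x))) (.not (.lt (.upper x) (.upper d))))))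

/-- `Intervals.Proper` for variable `x` in scope `d`. -/
def proper (d x : ℕ) : Formula := .and (nontriv x) (.not (big d x))

/-- `Intervals.IsStart` for variable `x` in scope `d`. -/
def isStart (d x : ℕ) : Formula :=
  .not (.ex (.and (proper (d + 1) d) (.and (.lt (.lower d) (.lower x)) (.lt (.lower x) (.upper d)))))

/-- `Intervals.Before` for variables `x` and `z` in scope `d`. -/
def before (d x z : ℕ) : Formula :=
  .and (proper d z) (.and (.not (.lt (.lower x) (.lower z)))
    (.not (.ex (.and (proper (d + 1) d) (.and (isStart (d + 1) d)
      (.and (.lt (.lower z) (.lower d)) (.not (.lt (.lower x) (.lower d)))))))))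

/-- `Intervals.OddPos` for variable `x` in scope `d`. -/
def oddPos (d x : ℕ) : Formula := .odd (before (d + 1) x d)

/-- `Intervals.Leaf` for variables `y` and `x` in scope `d`. -/
def leaf (d y x : ℕ) : Formula :=
  .and (unqueried y) (.and (unqueried x) (.and (adj y x)
    (.not (.ex (.and (unqueried d) (.and (adj y d) (ne d x)))))))

/-- `Input.Urgent` for variable `x` in scope `d`. -/
def urgent (d x : ℕ) : Formula :=
  .and (unqueried x) (or (big d x) (.ex (.and (ne d x) (or
    (.and (.lt (.lower x) (.pred d)) (.lt (.pred d) (.upper x)))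
    (.and (.lt (.lower x) (.value d)) (.lt (.value d) (.upper x)))))))

/-- `Input.Rule` for variable `0`. -/
def rule : Formula :=
  or (urgent 1 0) (.and (.not (.ex (urgent 2 1))) (.ex (.and (leaf 2 1 0) (or (oddPos 2 1)
    (.not (.ex (.ex (.and (oddPos 4 3) (leaf 4 3 2)))))))))

variable {I : Input n} {w : Fin n → ℝ} {l : List (Fin n)} {d x y z : ℕ} {e : ℕ → Fin n}

@[simp] theorem sat_not {φ : Formula} : (not φ).Sat I w l d e ↔ ¬ φ.Sat I w l d e := Iff.rfl

@[simp] theorem sat_and {φ ψ : Formula} :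
    (and φ ψ).Sat I w l d e ↔ φ.Sat I w l d e ∧ ψ.Sat I w l d e := Iff.rfl

@[simp] theorem sat_ex {φ : Formula} :
    (ex φ).Sat I w l d e ↔ ∃ i, φ.Sat I w l (d + 1) (Function.update e d i) := Iff.rfl

@[simp] theorem sat_or {φ ψ : Formula} :
    (or φ ψ).Sat I w l d e ↔ φ.Sat I w l d e ∨ ψ.Sat I w l d e := by
  simp [or, or_iff_not_and_not]

@[simp] theorem sat_ne : (ne x y).Sat I w l d e ↔ e x ≠ e y := by
  simp [ne, Sat]

@[simp] theorem sat_lt {a b : Ref} : (lt a b).Sat I w l d e ↔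
    a.Known l e ∧ b.Known l e ∧ a.real I w e < b.real I w e := Iff.rfl

@[simp] theorem sat_nontriv : (nontriv x).Sat I w l d e ↔ I.Nontriv (e x) := by
  simp [nontriv, Ref.Known, Ref.real, Intervals.Nontriv]

/-- A comparison with an unrevealed value fails, whereas the value of a queried non-trivial interval
exceeds its left endpoint strictly. So the comparison in `queried` detects queries. -/
theorem sat_unqueried (hw : I.IsRealization w) :
    (unqueried x).Sat I w l d e ↔ I.Nontriv (e x) ∧ e x ∉ l := by
  simp only [unqueried, sat_and, sat_nontriv, sat_not, queried, sat_lt, Ref.Known, Ref.real, true_and,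
    not_and]
  exact and_congr_right fun h => ⟨fun h' hx => h' hx (hw.inside h).1, fun h' hx => absurd hx h'⟩

@[simp] theorem sat_adj : (adj x y).Sat I w l d e ↔ I.Adj (e x) (e y) := by
  simp [adj, Ref.Known, Ref.real, Intervals.Adj]

theorem sat_big (hx : x < d) : (big d x).Sat I w l d e ↔ I.Big (e x) := by
  simp [big, Ref.Known, Ref.real, Intervals.Big, Function.update_of_ne hx.ne]

theorem sat_proper (hx : x < d) : (proper d x).Sat I w l d e ↔ I.Proper (e x) := by
  simp [proper, sat_big hx, Intervals.Proper]

theorem sat_isStart (hx : x < d) : (isStart d x).Sat I w l d e ↔ I.IsStart (e x) := by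
  simp [isStart, sat_proper, Ref.Known, Ref.real, Intervals.IsStart, Function.update_of_ne hx.ne]

theorem sat_before (hx : x < d) (hz : z < d) :
    (before d x z).Sat I w l d e ↔ I.Before (e x) (e z) := by
  simp [before, sat_proper, hz, sat_isStart, Ref.Known, Ref.real, Intervals.Before,
    Function.update_of_ne hx.ne, Function.update_of_ne hz.ne]

theorem sat_oddPos (hx : x < d) : (oddPos d x).Sat I w l d e ↔ I.OddPos (e x) := by
  classical
  change Odd (Finset.univ.filter fun i =>
    (before (d + 1) x d).Sat I w l (d + 1) (Function.update e d i)).card ↔ _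
  simp only [Intervals.OddPos, sat_before (Nat.lt_succ_of_lt hx) (Nat.lt_succ_self d), Function.update_self,
    Function.update_of_ne hx.ne]

theorem sat_leaf (hw : I.IsRealization w) (hx : x < d) (hy : y < d) :
    (leaf d y x).Sat I w l d e ↔ I.Leaf l (e y) (e x) := by
  simp only [leaf, sat_and, sat_unqueried hw, sat_adj, sat_not, sat_ex, sat_ne, Function.update_self,
    Function.update_of_ne hx.ne, Function.update_of_ne hy.ne, Intervals.Leaf]
  constructor
  · rintro ⟨⟨-, h₁⟩, ⟨-, h₂⟩, h₃, h₄⟩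
    refine ⟨h₁, h₂, h₃, fun z hz hyz => ?_⟩
    by_contra hne
    exact h₄ ⟨z, ⟨hyz.2.2.1, hz⟩, hyz, hne⟩
  · rintro ⟨h₁, h₂, h₃, h₄⟩
    exact ⟨⟨h₃.2.1, h₁⟩, ⟨h₃.2.2.1, h₂⟩, h₃, fun ⟨z, hz, hyz, hne⟩ => hne (h₄ z hz.2 hyz)⟩

theorem sat_urgent (hw : I.IsRealization w) (hx : x < d) :
    (urgent d x).Sat I w l d e ↔ I.Urgent w l (e x) := by
  simp only [urgent, sat_and, sat_unqueried hw, sat_or, sat_big hx, sat_ex, sat_ne, sat_lt, Ref.Known,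
    Ref.real, Function.update_self, Function.update_of_ne hx.ne, true_and, Input.Urgent,
    Input.PredHit, Intervals.Inside]
  constructor
  · rintro ⟨⟨-, h⟩, hb | ⟨j, hj, hp | ⟨⟨hl, h₁⟩, -, h₂⟩⟩⟩
    · exact ⟨h, Or.inl hb⟩
    · exact ⟨h, Or.inr (Or.inl ⟨j, hj, hp⟩)⟩
    · exact ⟨h, Or.inr (Or.inr ⟨j, hl, hj, h₁, h₂⟩)⟩
  · rintro ⟨h, hb | ⟨j, hj, hp⟩ | ⟨j, hl, hj, hp⟩⟩
    · exact ⟨⟨hb.nontriv, h⟩, Or.inl hb⟩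
    · exact ⟨⟨hp.1.trans hp.2, h⟩, Or.inr ⟨j, hj, Or.inl hp⟩⟩
    · exact ⟨⟨hp.1.trans hp.2, h⟩, Or.inr ⟨j, hj, Or.inr ⟨⟨hl, hp.1⟩, hl, hp.2⟩⟩⟩

theorem sat_rule (hw : I.IsRealization w) : rule.Sat I w l 1 e ↔ I.Rule w l (e 0) := by
  simp only [rule, sat_or, sat_and, sat_not, sat_ex, sat_urgent hw (show 0 < 1 by simp),
    sat_urgent hw (show 1 < 2 by simp), sat_leaf hw (show 0 < 2 by simp) (show 1 < 2 by simp),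
    sat_leaf hw (show 2 < 4 by simp) (show 3 < 4 by simp), sat_oddPos (show 1 < 2 by simp),
    sat_oddPos (show 3 < 4 by simp), Input.Rule, Input.PairRule]
  simp

theorem closed_rule : rule.closed 1 = true := by decide

/-! ### The output order. -/

/-- A case distinction on whether the element `x` has been queried. -/
def cases (x : ℕ) (φ ψ : Formula) : Formula :=
  or (.and (queried x) φ) (.and (.not (queried x)) ψ)

/-- Comparison of left endpoints after the queries. -/
def lowLt (x y : ℕ) : Formula :=
  cases x (cases y (.lt (.value x) (.value y)) (.lt (.value x) (.lower y)))
    (cases y (.lt (.lower x) (.value y)) (.lt (.lower x) (.lower y)))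

/-- Comparison of right endpoints after the queries. -/
def highLt (x y : ℕ) : Formula :=
  cases x (cases y (.lt (.value x) (.value y)) (.lt (.value x) (.upper y)))
    (cases y (.lt (.upper x) (.value y)) (.lt (.upper x) (.upper y)))

/-- The element `1` precedes the element `0` in the output. -/
def precedes : Formula :=
  or (lowLt 1 0) (.and (.not (lowLt 0 1))
    (or (highLt 1 0) (.and (.not (highLt 0 1)) (.idxLt 1 0))))

theorem closed_precedes : precedes.closed 2 = true := by decide

theorem sat_queried (hw : I.IsRealization w) (hl : ∀ x ∈ l, I.Nontriv x) :
    (queried x).Sat I w l d e ↔ e x ∈ l := by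
  simp only [queried, sat_lt, Ref.Known, Ref.real, true_and, and_iff_left_iff_imp]
  exact fun h => (hw.inside (hl _ h)).1

theorem sat_lowLt (hw : I.IsRealization w) (hl : ∀ x ∈ l, I.Nontriv x) :
    (lowLt x y).Sat I w l d e ↔ I.low w {x | x ∈ l} (e x) < I.low w {x | x ∈ l} (e y) := by
  simp only [lowLt, cases, sat_or, sat_and, sat_not, sat_queried hw hl, sat_lt, Ref.Known, Ref.real,
    Intervals.low, Set.mem_ofPred_eq]
  by_cases hx : e x ∈ l <;> by_cases hy : e y ∈ l <;> simp [hx, hy]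

theorem sat_highLt (hw : I.IsRealization w) (hl : ∀ x ∈ l, I.Nontriv x) :
    (highLt x y).Sat I w l d e ↔ I.high w {x | x ∈ l} (e x) < I.high w {x | x ∈ l} (e y) := by
  simp only [highLt, cases, sat_or, sat_and, sat_not, sat_queried hw hl, sat_lt, Ref.Known,
    Ref.real, Intervals.high, Set.mem_ofPred_eq]
  by_cases hx : e x ∈ l <;> by_cases hy : e y ∈ l <;> simp [hx, hy]

end Formula

/-- The sort key of an element in the output. -/
noncomputable def outputKey (I : Intervals n) (w : Fin n → ℝ) (l : List (Fin n)) (x : Fin n) :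
    ℝ ×ₗ ℝ ×ₗ Fin n :=
  toLex (I.low w {x | x ∈ l} x, toLex (I.high w {x | x ∈ l} x, x))

theorem outputKey_injective (I : Intervals n) (w : Fin n → ℝ) (l : List (Fin n)) :
    Function.Injective (outputKey I w l) := fun _ _ h =>
  congrArg (fun p : ℝ ×ₗ ℝ ×ₗ Fin n => (ofLex (ofLex p).2).2) h

/-- The index as last component of the key makes ranks distinct, so that no two elements are written
to the same output cell. -/
theorem Formula.sat_precedes {I : Input n} {w : Fin n → ℝ} {l : List (Fin n)} {e : ℕ → Fin n}
    (hw : I.IsRealization w) (hl : ∀ x ∈ l, I.Nontriv x) :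
    precedes.Sat I w l 2 e ↔
      outputKey I.toIntervals w l (e 1) < outputKey I.toIntervals w l (e 0) := by
  simp only [precedes, sat_or, sat_lowLt hw hl, sat_highLt hw hl, outputKey,
    Prod.Lex.toLex_lt_toLex, Sat]
  grind

open Classical in
/-- Injective keys determine a permutation that sorts by rank. -/
theorem exists_perm_rank {α : Type*} [LinearOrder α] (k : Fin n → α) (hk : Function.Injective k) :
    ∃ σ : Equiv.Perm (Fin n), (∀ x, (Finset.univ.filter fun y => k y < k x).card = σ.symm x) ∧
      Monotone (k ∘ σ) := by
  refine ⟨Tuple.sort k, fun x => ?_, Tuple.monotone_sort k⟩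
  have hs : StrictMono (k ∘ Tuple.sort k) :=
    (Tuple.monotone_sort k).strictMono_of_injective (hk.comp (Equiv.injective _))
  rw [← Fin.card_Iio, ← Finset.card_map (s := Finset.Iio _) (Tuple.sort k).toEmbedding]
  congr 1
  ext y
  simp only [Finset.mem_filter, Finset.mem_univ, true_and, Finset.mem_map_equiv, Finset.mem_Iio]
  simpa using (hs.lt_iff_lt (a := (Tuple.sort k).symm y) (b := (Tuple.sort k).symm x))

/-! ### The program and the main theorem. -/

/-- The program: query by the rule, then output the order. -/
def sortProg : Prog := .seq (.queryLoop .rule) (.outputLoop .precedes)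

open Polynomial in
/-- A bound on the running time of `sortProg`. -/
noncomputable def sortTime : Polynomial ℕ :=
  (X * (X * (Formula.rule.cost + 4) + 4) + 2) + (X * (X * (Formula.precedes.cost + 3) + 6) + 2)

theorem exec_sortProg (I : Input n) {w : Fin n → ℝ} (hw : I.IsRealization w) :
    ∃ s t, Exec I w sortProg (State.init n) s t ∧ t ≤ sortTime.eval n ∧ s.OutputsSorted w ∧
      Reach (I.Rule w) s.log := by
  classical
  obtain ⟨s₁, t₁, h₁, ht₁, hr, hstuck⟩ := Exec.queryLoop (I := I) (w := w) Formula.closed_rule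
    (fun _ _ => Formula.sat_rule hw) (fun _ _ => Input.Rule.notMem) (State.init n) Reach.nil
  obtain ⟨σ, hσ, hmono⟩ := exists_perm_rank _ (outputKey_injective I.toIntervals w s₁.log)
  obtain ⟨s₂, t₂, h₂, ht₂, hl, hout⟩ := Exec.outputLoop (I := I) (w := w) Formula.closed_precedes s₁
    (B := fun y x => outputKey I.toIntervals w s₁.log y < outputKey I.toIntervals w s₁.log x)
    (fun _ => Formula.sat_precedes hw (Input.nontriv_of_reach hr)) σ
    fun x => by convert hσ x
  refine ⟨s₂, t₁ + t₂, Exec.seq h₁ h₂, ?_, ⟨σ, hout, fun a b hab => ?_⟩, hl ▸ hr⟩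
  · simp only [sortTime, Polynomial.eval_add, Polynomial.eval_mul, Polynomial.eval_X,
      Polynomial.eval_ofNat]
    omega
  · have hab := hmono hab
    simp only [Function.comp, outputKey, Prod.Lex.toLex_le_toLex] at hab
    refine (Input.determined_of_stuck hw hstuck).le_of_low_le hw hw (fun _ _ => rfl) ?_
    exact hab.imp_right fun h => ⟨h.1, h.2.elim le_of_lt fun h => h.1.le⟩

end UncertainSorting

theorem mainTheorem5 :
    ∃ (alg : UncertainSorting.Prog) (p : Polynomial ℕ),
      ∀ (n : ℕ) (I : UncertainSorting.Input n) (w : Fin n → ℝ), I.IsRealization w →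
        ∃ (s : UncertainSorting.State n) (t : ℕ),
          UncertainSorting.Exec I w alg (UncertainSorting.State.init n) s t ∧
          t ≤ p.eval n ∧
          s.OutputsSorted w ∧
          s.log.Nodup ∧
          (∀ i ∈ s.log, ¬ I.Trivial i) ∧
          ∀ k ∈ ({I.numErrors w, I.mandatoryDist w, I.hopDist w} : Set ℕ),
            (s.log.length : ℝ) ≤ min (1 + (k : ℝ) / I.opt w) 2 * I.opt w := by
  refine ⟨UncertainSorting.sortProg, UncertainSorting.sortTime, fun n I w hw => ?_⟩
  obtain ⟨s, t, hs, ht, hout, hr⟩ := UncertainSorting.exec_sortProg I hw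
  refine ⟨s, t, hs, ht, hout, hr.nodup fun _ _ => UncertainSorting.Input.Rule.notMem,
    fun i hi => UncertainSorting.Intervals.not_trivial_iff.2
      (UncertainSorting.Input.nontriv_of_reach hr i hi), fun k hk => ?_⟩
  obtain ⟨Q, hQ, hcard⟩ :=
    UncertainSorting.Intervals.exists_feasible_card_eq_opt (I := I.toIntervals) w
  have h₂ := UncertainSorting.Input.length_le_two_mul_card hw hr hQ
  have hk' : s.log.length ≤ Q.card + k := by
    simp only [Set.mem_insert_iff, Set.mem_singleton_iff] at hk
    have hM := UncertainSorting.Input.length_le_card_add_mandatoryDist hw hr hQ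
    rcases hk with rfl | rfl | rfl
    · exact UncertainSorting.Input.length_le_card_add_numErrors hw hr hQ
    · exact hM
    · exact hM.trans (Nat.add_le_add_left (I.mandatoryDist_le_hopDist hw) _)
  rw [hcard] at h₂ hk'
  have h₂' : (s.log.length : ℝ) ≤ 2 * I.opt w := by exact_mod_cast h₂
  have hk'' : (s.log.length : ℝ) ≤ I.opt w + k := by exact_mod_cast hk'
  -- If the optimum is zero, the quotient has the default value zero and the right-hand side
  -- vanishes; the factor-two bound already excludes any query.
  rcases Nat.eq_zero_or_pos (I.opt w) with h0 | hpos
  · rw [h0] at h₂' ⊢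
    simpa using h₂'
  · have hpos' : (0 : ℝ) < I.opt w := by exact_mod_cast hpos
    rw [min_mul_of_nonneg _ _ hpos'.le, add_mul, one_mul, div_mul_cancel₀ _ hpos'.ne']
    exact le_min hk'' h₂'
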